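/- Let $(\overline M^{2m+1},\varphi,\xi,\eta,\bar g)$ be a smooth almost contact metric manifold, i.e. $\varphi^2X=-X+\eta(X)\xi$, $\eta(\xi)=1$, $\varphi\xi=0$, $\eta=\bar g(\xi,\cdot)$ and $\bar g(\varphi X,\varphi Y)=\bar g(X,Y)-\eta(X)\eta(Y)$. Let $\overline\nabla$ be the Levi-Civita connection of $\bar g$ and $\overline R(X,Y)=[\overline\nabla_X,\overline\nabla_Y]-\overline\nabla_{[X,Y]}$ its curvature. Assume that $\overline M=\overline M^{2m+1}(c)$ is a Sasakian space form, that is, $$d\eta(X,Y)=\bar g(X,\varphi Y),\qquad(\overline\nabla_X\varphi)Y=\bar g(X,Y)\xi-\eta(Y)X$$ (with $2\,d\eta(X,Y)=X\eta(Y)-Y\eta(X)-\eta([X,Y])$), and for a constant $c\in\mathbb R$ $$\begin{aligned}\overline R(X,Y)Z={}&-\tfrac{c-1}{4}\big\{\eta(Z)[\eta(Y)X-\eta(X)Y]+[\bar g(Y,Z)\eta(X)-\bar g(X,Z)\eta(Y)]\xi\\&+\bar g(\varphi X,Z)\varphi Y+2\bar g(\varphi X,Y)\varphi Z-\bar g(\varphi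 Y,Z)\varphi X\big\}+\tfrac{c+3}{4}\{\bar g(Y,Z)X-\bar g(X,Z)Y\}.\end{aligned}$$ Assume further that the Ricci tensor $\mathsf{Ric}$ of $\bar g$ is positive definite, so that it is a Riemannian metric on $\overline M$; let $\nabla^\star$ and $R^\star$ be its Levi-Civita connection and curvature. Let $\psi:M^{2m}\to\overline M^{2m+1}(c)$ be a smooth immersion of a nonempty manifold. Let $g=\psi^*\bar g$, let $B$ be the second fundamental form of $\psi$ with respect to $\bar g$, $H=\frac1{2m}\operatorname{trace}_gB$ the mean curvature vector field, $|H|=\bar g(H,H)^{1/2}$, $\mathsf{grad}|H|$ the gradient of $|H|$ with respect to $g$, and, for a unit normal $N$ (with respect to $\bar g$), let $A$ be the Weingarten operator, $g(AX,Y)=\bar g(B(X,Y),N)$. The hypersurface is called * pseudo-Hopf if $\xi$ is tangent to $M$ and, with $V=-\varphi N$, $A$ maps $\mathsf{Span}\{\xi,V\}$ into itself at every point; * Ricci-biharmonic if $\tau_2^\star(\psi)=-\Delta^\star H-\operatorname{trace}R^\star(d\psi(\cdot),H)d\psi(\cdot)=0$, where $\Delta^\star=-\operatorname{trace}(\nabla^\star)^2$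 is the rough Laplacian on sections of $\psi^{-1}T\overline M$, and $M$ carries the metric $\psi^*\mathsf{Ric}$, which is used for both traces and, through its Levi-Civita connection, for the second covariant derivative. Then there is no such $\psi$ that is pseudo-Hopf and Ricci-biharmonic and for which $\mathsf{grad}|H|$ is a principal direction, i.e. for which $\mathsf{grad}|H|$ is at every point of $M$ an eigenvector (in particular nonzero) of $A$. -/

import Mathlib

set_option maxSynthPendingDepth 3

open scoped Manifold ContDiff Bundle

noncomputable section

namespace RicciBiharmonic

/-- The Euclidean space `ℝⁿ`, on which `n`-dimensional manifolds are modelled. -/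
abbrev Euc (n : ℕ) : Type := EuclideanSpace ℝ (Fin n)

/-- A field of bilinear forms on (an open subset of) `ℝⁿ`, the coordinate expression `G_{ij}` of
a metric in a chart. -/
abbrev FormField (n : ℕ) : Type := Euc n → Euc n →L[ℝ] Euc n →L[ℝ] ℝ

/-! ### Riemannian geometry in coordinates -/

section Local

variable {F : Type*} [NormedAddCommGroup F] [NormedSpace ℝ F]

/-- The Christoffel symbols of the first kind,
`(u, v, w) ↦ (∂_u G(v, w) + ∂_v G(u, w) - ∂_w G(u, v)) / 2`. -/
def koszul (G : F → F →L[ℝ] F →L[ℝ] ℝ) (y : F) : F →L[ℝ] F →L[ℝ] F →L[ℝ] ℝ :=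
  (1 / 2 : ℝ) • (fderiv ℝ G y + (fderiv ℝ G y).flip -
    ((ContinuousLinearMap.flipₗᵢ ℝ F F ℝ).toContinuousLinearEquiv :
      (F →L[ℝ] F →L[ℝ] ℝ) →L[ℝ] (F →L[ℝ] F →L[ℝ] ℝ)) ∘L (fderiv ℝ G y).flip)

theorem koszul_apply (G : F → F →L[ℝ] F →L[ℝ] ℝ) (y u v w : F) :
    koszul G y u v w =
      (1 / 2 : ℝ) * (fderiv ℝ G y u v w + fderiv ℝ G y v u w - fderiv ℝ G y w u v) := by
  simp [koszul]

/-- The Christoffel symbols `Γ(u, v)` of the Levi-Civita connection of `G`, characterised by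
`G(Γ(u, v), w) = koszul G u v w` when `G` is nondegenerate. -/
def christoffel (G : F → F →L[ℝ] F →L[ℝ] ℝ) (y : F) : F →L[ℝ] F →L[ℝ] F :=
  ContinuousLinearMap.compL ℝ F (F →L[ℝ] ℝ) F (G y).inverse ∘L koszul G y

/-- The curvature tensor `R(u, v)w = [∇_u, ∇_v]w - ∇_{[u, v]}w` of the Levi-Civita connection of
`G`, evaluated on constant coordinate fields. -/
def curvature (G : F → F →L[ℝ] F →L[ℝ] ℝ) (y u v w : F) : F :=
  fderiv ℝ (christoffel G) y u v w - fderiv ℝ (christoffel G) y v u w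
    + christoffel G y u (christoffel G y v w) - christoffel G y v (christoffel G y u w)

variable {k n : ℕ}

/-- The Ricci tensor `Ric(v, w) = trace (u ↦ R(u, v)w)` on vectors. -/
def ricci (G : FormField n) (y v w : Euc n) : ℝ :=
  ∑ i, curvature G y (EuclideanSpace.single i 1) v w i

/-- The Ricci tensor as a field of bilinear forms, `∑ Ric_{ij} dxⁱ ⊗ dxʲ`. -/
def ricciForm (G : FormField n) : FormField n := fun y =>
  ∑ i, ∑ j, ricci G y (EuclideanSpace.single i 1) (EuclideanSpace.single j 1) •
    (EuclideanSpace.proj i : Euc n →L[ℝ] ℝ).smulRight (EuclideanSpace.proj j : Euc n →L[ℝ] ℝ)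

/-- The trace `∑ h^{ij} S(eᵢ, eⱼ)` of `S` with respect to the inner product `h`; the vector
`h.inverse dxⁱ` is `∑ⱼ h^{ij} eⱼ`. -/
def metricTrace (h : Euc k →L[ℝ] Euc k →L[ℝ] ℝ) (S : Euc k → Euc k → Euc n) : Euc n :=
  ∑ i, S (EuclideanSpace.single i 1)
    (h.inverse (EuclideanSpace.proj i : Euc k →L[ℝ] ℝ))

/-- The metric `f^*G` induced by the map `f`. -/
def induced (G : FormField n) (f : Euc k → Euc n) : FormField k := fun x =>
  (G (f x)).bilinearComp (fderiv ℝ f x) (fderiv ℝ f x)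

/-- The covariant derivative `∇_u σ` of a vector field `σ` along `f`, in the pullback of the
Levi-Civita connection of `G`. -/
def covAlong (G : FormField n) (f σ : Euc k → Euc n) (x u : Euc k) : Euc n :=
  fderiv ℝ σ x u + christoffel G (f x) (fderiv ℝ f x u) (σ x)

/-- The second covariant derivative `∇²_{u, v} σ = ∇_u ∇_v σ - ∇_{∇_u v} σ` of a vector field along
`f`, where the source carries the Levi-Civita connection of the induced metric `f^*G`. -/
def covAlong₂ (G : FormField n) (f σ : Euc k → Euc n) (x u v : Euc k) : Euc n :=
  covAlong G f (fun z => covAlong G f σ z v) x u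
    - covAlong G f σ x (christoffel (induced G f) x u v)

/-- The rough Laplacian `Δσ = - trace ∇²σ` on vector fields along `f`. -/
def laplacian (G : FormField n) (f σ : Euc k → Euc n) (x : Euc k) : Euc n :=
  -metricTrace (induced G f x) (covAlong₂ G f σ x)

/-- The second fundamental form `B(u, v) = ∇_u (df v) - df (∇_u v)` of `f` with respect to `G` and
the induced metric. -/
def secondForm (G : FormField n) (f : Euc k → Euc n) (x : Euc k) :
    Euc k →L[ℝ] Euc k →L[ℝ] Euc n :=
  fderiv ℝ (fderiv ℝ f) x + (christoffel G (f x)).bilinearComp (fderiv ℝ f x) (fderiv ℝ f x)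
    - ContinuousLinearMap.compL ℝ (Euc k) (Euc k) (Euc n) (fderiv ℝ f x) ∘L
        christoffel (induced G f) x

/-- The mean curvature vector field `H = (1 / k) trace B`. -/
def meanCurv (G : FormField n) (f : Euc k → Euc n) (x : Euc k) : Euc n :=
  (1 / (k : ℝ)) • metricTrace (induced G f x) (fun u v => secondForm G f x u v)

/-- The length `|H|` of the mean curvature vector field. -/
def meanCurvNorm (G : FormField n) (f : Euc k → Euc n) (x : Euc k) : ℝ :=
  √(G (f x) (meanCurv G f x) (meanCurv G f x))

/-- The gradient of `|H|` with respect to the induced metric. -/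
def gradMeanCurvNorm (G : FormField n) (f : Euc k → Euc n) (x : Euc k) : Euc k :=
  (induced G f x).inverse (fderiv ℝ (meanCurvNorm G f) x)

/-- `ν` is a unit normal vector of `f` at `x`. -/
def IsUnitNormal (G : FormField n) (f : Euc k → Euc n) (x : Euc k) (ν : Euc n) : Prop :=
  (∀ u, G (f x) ν (fderiv ℝ f x u) = 0) ∧ G (f x) ν ν = 1

/-- The Weingarten operator `A` in the direction of the normal vector `ν`:
`g(A u, v) = G(B(u, v), ν)`. -/
def weingarten (G : FormField n) (f : Euc k → Euc n) (x : Euc k) (ν : Euc n) :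
    Euc k →L[ℝ] Euc k :=
  (induced G f x).inverse ∘L
    ContinuousLinearMap.compL ℝ (Euc k) (Euc n) ℝ (G (f x) ν) ∘L secondForm G f x

/-- The bitension field `τ₂* = - Δ*H - trace R*(df ·, H) df ·`, where `H` is the mean curvature
vector field with respect to `G`, while `Δ*`, `R*` and both traces belong to the isometric
immersion `f` into the space with the metric `Ric`. -/
def ricciBitension (G : FormField n) (f : Euc k → Euc n) (x : Euc k) : Euc n :=
  -laplacian (ricciForm G) f (meanCurv G f) x
    - metricTrace (induced (ricciForm G) f x) (fun u v =>
        curvature (ricciForm G) (f x) (fderiv ℝ f x u) (meanCurv G f x) (fderiv ℝ f x v))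

end Local

/-! ### Sasakian space forms -/

section Ambient

/-- An almost contact metric structure `(φ, ξ, η, g)` on a smooth manifold. The form `η` is smooth
because `η = g(ξ, ·)`. -/
structure AlmostContactMetric (n : ℕ) (N : Type*) [TopologicalSpace N] [ChartedSpace (Euc n) N]
    [IsManifold (𝓡 n) ∞ N] where
  g : Bundle.ContMDiffRiemannianMetric (𝓡 n) ∞ (Euc n) (fun x : N => TangentSpace (𝓡 n) x)
  φ : ContMDiffSection (𝓡 n) (Euc n →L[ℝ] Euc n) ∞
    (fun x : N => TangentSpace (𝓡 n) x →L[ℝ] TangentSpace (𝓡 n) x)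
  ξ : ContMDiffSection (𝓡 n) (Euc n) ∞ (fun x : N => TangentSpace (𝓡 n) x)
  η : (x : N) → TangentSpace (𝓡 n) x →L[ℝ] ℝ
  φ_φ : ∀ (x : N) (u : TangentSpace (𝓡 n) x), φ x (φ x u) = -u + η x u • ξ x
  η_ξ : ∀ x : N, η x (ξ x) = 1
  φ_ξ : ∀ x : N, φ x (ξ x) = 0
  η_eq : ∀ (x : N) (u : TangentSpace (𝓡 n) x), η x u = g.inner x (ξ x) u
  g_φ_φ : ∀ (x : N) (u v : TangentSpace (𝓡 n) x),
    g.inner x (φ x u) (φ x v) = g.inner x u v - η x u * η x v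

variable {n : ℕ} {N : Type*} [TopologicalSpace N] [ChartedSpace (Euc n) N]
  [IsManifold (𝓡 n) ∞ N]

namespace AlmostContactMetric

variable (S : AlmostContactMetric n N)

/-- The coordinate frame of the chart at `x₀`: the differential of the inverse chart. -/
def frame (x₀ : N) (y : Euc n) :
    Euc n →L[ℝ] TangentSpace (𝓡 n) ((extChartAt (𝓡 n) x₀).symm y) :=
  mfderiv 𝓘(ℝ, Euc n) (𝓡 n) (extChartAt (𝓡 n) x₀).symm y

/-- The differential of the chart at `x₀`. -/
def coframe (x₀ : N) (y : Euc n) :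
    TangentSpace (𝓡 n) ((extChartAt (𝓡 n) x₀).symm y) →L[ℝ] Euc n :=
  mfderiv (𝓡 n) 𝓘(ℝ, Euc n) (extChartAt (𝓡 n) x₀) ((extChartAt (𝓡 n) x₀).symm y)

/-- The metric in the chart at `x₀`. -/
def locG (x₀ : N) : FormField n := fun y =>
  (frame x₀ y).precomp ℝ ∘L S.g.inner ((extChartAt (𝓡 n) x₀).symm y) ∘L frame x₀ y

/-- The tensor field `φ` in the chart at `x₀`. -/
def locφ (x₀ : N) (y : Euc n) : Euc n →L[ℝ] Euc n :=
  coframe x₀ y ∘L S.φ ((extChartAt (𝓡 n) x₀).symm y) ∘L frame x₀ y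

/-- The vector field `ξ` in the chart at `x₀`. -/
def locξ (x₀ : N) (y : Euc n) : Euc n :=
  coframe x₀ y (S.ξ ((extChartAt (𝓡 n) x₀).symm y))

/-- The form `η` in the chart at `x₀`. -/
def locη (x₀ : N) (y : Euc n) : Euc n →L[ℝ] ℝ :=
  S.η ((extChartAt (𝓡 n) x₀).symm y) ∘L frame x₀ y

/-- The structure is Sasakian: `dη(u, v) = g(u, φ v)`, with the convention
`dη(u, v) = (u(η(v)) - v(η(u)) - η([u, v])) / 2`, and `(∇_u φ)v = g(u, v)ξ - η(v)u`. -/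
structure IsSasakian : Prop where
  contact : ∀ x₀ : N, ∀ y ∈ (extChartAt (𝓡 n) x₀).target, ∀ u v : Euc n,
    (1 / 2 : ℝ) * (fderiv ℝ (S.locη x₀) y u v - fderiv ℝ (S.locη x₀) y v u) =
      S.locG x₀ y u (S.locφ x₀ y v)
  sasaki : ∀ x₀ : N, ∀ y ∈ (extChartAt (𝓡 n) x₀).target, ∀ u v : Euc n,
    fderiv ℝ (S.locφ x₀) y u v + christoffel (S.locG x₀) y u (S.locφ x₀ y v)
        - S.locφ x₀ y (christoffel (S.locG x₀) y u v) =
      S.locG x₀ y u v • S.locξ x₀ y - S.locη x₀ y v • u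

/-- A Sasakian space form of constant `φ`-sectional curvature `c`. -/
structure IsSasakianSpaceForm (c : ℝ) : Prop extends IsSasakian S where
  curv : ∀ x₀ : N, ∀ y ∈ (extChartAt (𝓡 n) x₀).target, ∀ u v w : Euc n,
    let g := S.locG x₀ y
    let φ := S.locφ x₀ y
    let η := S.locη x₀ y
    let ξ := S.locξ x₀ y
    curvature (S.locG x₀) y u v w =
      -((c - 1) / 4) • (η w • (η v • u - η u • v) + (g v w * η u - g u w * η v) • ξ
          + g (φ u) w • φ v + (2 * g (φ u) v) • φ w - g (φ v) w • φ u)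
        + ((c + 3) / 4) • (g v w • u - g u w • v)

/-- The Ricci tensor is a Riemannian metric, that is, it is positive definite. -/
def RicciIsMetric : Prop :=
  ∀ x₀ : N, ∀ y ∈ (extChartAt (𝓡 n) x₀).target, ∀ u : Euc n, u ≠ 0 →
    0 < ricciForm (S.locG x₀) y u u

end AlmostContactMetric

end Ambient

/-! ### Hypersurfaces -/

section Hypersurface

variable {k n : ℕ} {N : Type*} [TopologicalSpace N] [ChartedSpace (Euc n) N]
  [IsManifold (𝓡 n) ∞ N] {M : Type*} [TopologicalSpace M] [ChartedSpace (Euc k) M]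

/-- The map `ψ` in the charts at `p₀` and `ψ p₀`. -/
def locMap (k n : ℕ) {N : Type*} [TopologicalSpace N] [ChartedSpace (Euc n) N]
    {M : Type*} [TopologicalSpace M] [ChartedSpace (Euc k) M] (ψ : M → N) (p₀ : M) :
    Euc k → Euc n :=
  writtenInExtChartAt (𝓡 k) (𝓡 n) p₀ ψ

/-- The open set of `ℝᵏ` on which `locMap k n ψ p₀` represents `ψ`. -/
def locDomain (k n : ℕ) {N : Type*} [TopologicalSpace N] [ChartedSpace (Euc n) N]
    {M : Type*} [TopologicalSpace M] [ChartedSpace (Euc k) M] (ψ : M → N) (p₀ : M) :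
    Set (Euc k) :=
  (extChartAt (𝓡 k) p₀).target ∩
    (extChartAt (𝓡 k) p₀).symm ⁻¹' (ψ ⁻¹' (extChartAt (𝓡 n) (ψ p₀)).source)

/-- A smooth map whose differential is injective at every point. -/
def IsSmoothImmersion (k n : ℕ) {N : Type*} [TopologicalSpace N] [ChartedSpace (Euc n) N]
    {M : Type*} [TopologicalSpace M] [ChartedSpace (Euc k) M] (ψ : M → N) : Prop :=
  ContMDiff (𝓡 k) (𝓡 n) ∞ ψ ∧ ∀ p, Function.Injective (mfderiv (𝓡 k) (𝓡 n) ψ p)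

/-- The immersion is Ricci-biharmonic: `τ₂* = 0`. -/
def IsRicciBiharmonic (S : AlmostContactMetric n N) (ψ : M → N) : Prop :=
  ∀ p₀ : M, ∀ x ∈ locDomain k n ψ p₀,
    ricciBitension (S.locG (ψ p₀)) (locMap k n ψ p₀) x = 0

/-- A pseudo-Hopf hypersurface: `ξ` is tangent to it, and for every unit normal `ν`, with
`V = -φν`, the Weingarten operator maps `D^⊥ = span {ξ, V}`, regarded as a subspace of the tangent
space of the hypersurface, into itself. -/
structure IsPseudoHopf (S : AlmostContactMetric n N) (ψ : M → N) : Prop where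
  tangent : ∀ p : M, S.ξ (ψ p) ∈ Set.range (mfderiv (𝓡 k) (𝓡 n) ψ p)
  invariant : ∀ p₀ : M, ∀ x ∈ locDomain k n ψ p₀, ∀ ν : Euc n,
    let G := S.locG (ψ p₀)
    let f := locMap k n ψ p₀
    IsUnitNormal G f x ν →
      let Dperp : Submodule ℝ (Euc k) :=
        (Submodule.span ℝ {S.locξ (ψ p₀) (f x), -S.locφ (ψ p₀) (f x) ν}).comap
          (fderiv ℝ f x : Euc k →ₗ[ℝ] Euc n)
      ∀ u ∈ Dperp, weingarten G f x ν u ∈ Dperp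

/-- `grad |H|` is a principal direction: at every point it is an eigenvector (in particular
nonzero) of the Weingarten operator. -/
def GradIsPrincipal (S : AlmostContactMetric n N) (ψ : M → N) : Prop :=
  ∀ p₀ : M, ∀ x ∈ locDomain k n ψ p₀, ∀ ν : Euc n,
    IsUnitNormal (S.locG (ψ p₀)) (locMap k n ψ p₀) x ν →
      ∃ μ : ℝ, Module.End.HasEigenvector
        (weingarten (S.locG (ψ p₀)) (locMap k n ψ p₀) x ν : Euc k →ₗ[ℝ] Euc k) μ
        (gradMeanCurvNorm (S.locG (ψ p₀)) (locMap k n ψ p₀) x)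

end Hypersurface

end RicciBiharmonic

end

namespace RicciBiharmonic

open scoped Topology
open Filter

/-! ### Inner products and traces -/

section Inner

variable {F : Type*} [NormedAddCommGroup F] [NormedSpace ℝ F]

/-- A bilinear form which is symmetric and positive definite. -/
structure IsInner (h : F →L[ℝ] F →L[ℝ] ℝ) : Prop where
  symm : ∀ u v, h u v = h v u
  pos : ∀ u, u ≠ 0 → 0 < h u u

namespace IsInner

variable {h : F →L[ℝ] F →L[ℝ] ℝ} (hh : IsInner h)
include hh

theorem eq_zero {u : F} (hu : h u u = 0) : u = 0 := by
  by_contra hne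
  exact (hh.pos u hne).ne' hu

theorem nonneg (u : F) : 0 ≤ h u u := by
  by_cases hu : u = 0
  · simp [hu]
  · exact (hh.pos u hu).le

theorem ext {u v : F} (huv : ∀ w, h u w = h v w) : u = v := by
  refine sub_eq_zero.1 (hh.eq_zero ?_)
  simp [huv]

variable [FiniteDimensional ℝ F]

theorem isInvertible : h.IsInvertible := by
  have hinj : Function.Injective (h : F →ₗ[ℝ] F →L[ℝ] ℝ) := fun u v huv =>
    hh.ext fun w => by
      have := congrArg (fun a : F →L[ℝ] ℝ => a w) huv
      exact this
  have hfr : Module.finrank ℝ F = Module.finrank ℝ (F →L[ℝ] ℝ) := by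
    rw [← (LinearMap.toContinuousLinearMap : (F →ₗ[ℝ] ℝ) ≃ₗ[ℝ] (F →L[ℝ] ℝ)).finrank_eq]
    exact (Subspace.dual_finrank_eq (K := ℝ) (V := F)).symm
  have : FiniteDimensional ℝ (F →L[ℝ] ℝ) :=
    (LinearMap.toContinuousLinearMap : (F →ₗ[ℝ] ℝ) ≃ₗ[ℝ] (F →L[ℝ] ℝ)).finiteDimensional
  refine ⟨(LinearMap.linearEquivOfInjective _ hinj hfr).toContinuousLinearEquiv, ?_⟩
  ext u v
  rfl

theorem apply_inverse (a : F →L[ℝ] ℝ) : h (h.inverse a) = a :=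
  hh.isInvertible.self_apply_inverse a

theorem inverse_apply (u : F) : h.inverse (h u) = u :=
  hh.isInvertible.inverse_apply_self u

theorem apply_inverse_right (a : F →L[ℝ] ℝ) (u : F) : h u (h.inverse a) = a u := by
  rw [hh.symm, hh.apply_inverse]

theorem apply_inverse_comm (a b : F →L[ℝ] ℝ) : a (h.inverse b) = b (h.inverse a) := by
  rw [← hh.apply_inverse_right a, hh.apply_inverse]

end IsInner

end Inner

section Trace

variable {k n : ℕ}

/-- The trace `∑ h^{ij} S(eᵢ, eⱼ)` of a scalar bilinear form. -/
noncomputable def formTrace (h : Euc k →L[ℝ] Euc k →L[ℝ] ℝ) (S : Euc k → Euc k → ℝ) : ℝ :=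
  ∑ i, S (EuclideanSpace.single i 1) (h.inverse (EuclideanSpace.proj i : Euc k →L[ℝ] ℝ))

theorem map_metricTrace (h : Euc k →L[ℝ] Euc k →L[ℝ] ℝ) (S : Euc k → Euc k → Euc n)
    (a : Euc n →L[ℝ] ℝ) : a (metricTrace h S) = formTrace h fun u v => a (S u v) := by
  simp [metricTrace, formTrace, map_sum]

theorem sum_apply_smul_single (u : Euc k) :
    ∑ i, u i • (EuclideanSpace.single i (1 : ℝ) : Euc k) = u := by
  ext j
  simp [Pi.single_apply]

theorem clm_eq_sum {E : Type*} [NormedAddCommGroup E] [NormedSpace ℝ E] (a : Euc k →L[ℝ] E)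
    (u : Euc k) : a u = ∑ i, u i • a (EuclideanSpace.single i 1) := by
  conv_lhs => rw [← sum_apply_smul_single u]
  simp [map_sum]

variable {h : Euc k →L[ℝ] Euc k →L[ℝ] ℝ}

theorem formTrace_add (S T : Euc k → Euc k → ℝ) :
    formTrace h (fun u v => S u v + T u v) = formTrace h S + formTrace h T := by
  simp [formTrace, Finset.sum_add_distrib]

theorem formTrace_sub (S T : Euc k → Euc k → ℝ) :
    formTrace h (fun u v => S u v - T u v) = formTrace h S - formTrace h T := by
  simp [formTrace, Finset.sum_sub_distrib]

theorem formTrace_neg (S : Euc k → Euc k → ℝ) :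
    formTrace h (fun u v => -S u v) = -formTrace h S := by
  simp [formTrace]

theorem formTrace_mul (r : ℝ) (S : Euc k → Euc k → ℝ) :
    formTrace h (fun u v => r * S u v) = r * formTrace h S := by
  simp [formTrace, Finset.mul_sum]

/-- The trace of a rank one form `a ⊗ b`. -/
theorem formTrace_mul_apply (a b : Euc k →L[ℝ] ℝ) :
    formTrace h (fun u v => a u * b v) = b (h.inverse a) := by
  have ha : a = ∑ i, a (EuclideanSpace.single i 1) • (EuclideanSpace.proj i : Euc k →L[ℝ] ℝ) := by
    ext u
    rw [clm_eq_sum a u]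
    simp [mul_comm]
  conv_rhs => rw [ha]
  simp [formTrace, map_sum]

section

variable (hh : IsInner h)
include hh

theorem formTrace_flip (S : Euc k →L[ℝ] Euc k →L[ℝ] ℝ) :
    formTrace h (fun u v => S v u) = formTrace h fun u v => S u v := by
  have key : ∀ i j : Fin k, h.inverse (EuclideanSpace.proj i : Euc k →L[ℝ] ℝ) j
      = h.inverse (EuclideanSpace.proj j : Euc k →L[ℝ] ℝ) i := by
    intro i j
    have h1 := hh.apply_inverse_right (EuclideanSpace.proj j : Euc k →L[ℝ] ℝ)
      (h.inverse (EuclideanSpace.proj i : Euc k →L[ℝ] ℝ))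
    have h2 := hh.apply_inverse_right (EuclideanSpace.proj i : Euc k →L[ℝ] ℝ)
      (h.inverse (EuclideanSpace.proj j : Euc k →L[ℝ] ℝ))
    rw [hh.symm] at h1
    exact h1.symm.trans h2
  simp only [formTrace]
  have e1 : ∀ i, S (h.inverse (EuclideanSpace.proj i : Euc k →L[ℝ] ℝ)) (EuclideanSpace.single i 1)
      = ∑ j, h.inverse (EuclideanSpace.proj i : Euc k →L[ℝ] ℝ) j *
        S (EuclideanSpace.single j 1) (EuclideanSpace.single i 1) := by
    intro i
    rw [clm_eq_sum S]
    simp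
  have e2 : ∀ i, S (EuclideanSpace.single i 1) (h.inverse (EuclideanSpace.proj i : Euc k →L[ℝ] ℝ))
      = ∑ j, h.inverse (EuclideanSpace.proj i : Euc k →L[ℝ] ℝ) j *
        S (EuclideanSpace.single i 1) (EuclideanSpace.single j 1) := by
    intro i
    rw [clm_eq_sum (S (EuclideanSpace.single i 1))]
    simp
  simp only [e1, e2]
  rw [Finset.sum_comm]
  exact Finset.sum_congr rfl fun i _ => Finset.sum_congr rfl fun j _ => by rw [key]

theorem formTrace_eq_zero_of_antisymm (S : Euc k →L[ℝ] Euc k →L[ℝ] ℝ)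
    (hS : ∀ u v, S u v = -S v u) : formTrace h (fun u v => S u v) = 0 := by
  have h1 := formTrace_flip hh S
  have h2 : formTrace h (fun u v => S v u) = -formTrace h fun u v => S u v := by
    rw [← formTrace_neg]
    congr 1
    ext u v
    exact hS v u
  linarith

theorem formTrace_inner_comp (L : Euc k →L[ℝ] Euc k) :
    formTrace h (fun u v => h (L u) v) = ∑ i, L (EuclideanSpace.single i 1) i := by
  refine Finset.sum_congr rfl fun i _ => ?_
  exact hh.apply_inverse_right (EuclideanSpace.proj i : Euc k →L[ℝ] ℝ) _

theorem sum_apply_eq_zero_of_skew (L : Euc k →L[ℝ] Euc k) (hL : ∀ u v, h (L u) v = -h u (L v)) :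
    ∑ i, L (EuclideanSpace.single i 1) i = 0 := by
  rw [← formTrace_inner_comp hh]
  exact formTrace_eq_zero_of_antisymm hh (h ∘L L) fun u v => by
    simp only [ContinuousLinearMap.comp_apply]
    rw [hL, hh.symm]

end

theorem sum_comp_comm (L P : Euc k →L[ℝ] Euc k) :
    ∑ i, L (P (EuclideanSpace.single i 1)) i = ∑ i, P (L (EuclideanSpace.single i 1)) i := by
  have e : ∀ (L P : Euc k →L[ℝ] Euc k) (i : Fin k), L (P (EuclideanSpace.single i 1)) i
      = ∑ j, P (EuclideanSpace.single i 1) j * L (EuclideanSpace.single j 1) i := by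
    intro L P i
    rw [clm_eq_sum L]
    simp
  simp only [e]
  rw [Finset.sum_comm]
  exact Finset.sum_congr rfl fun i _ => Finset.sum_congr rfl fun j _ => mul_comm _ _

end Trace

/-! ### The Levi-Civita connection in coordinates -/

section LeviCivita

variable {F : Type*} [NormedAddCommGroup F] [NormedSpace ℝ F]

/-- `G` is a smooth Riemannian metric on the open set `W`. -/
structure RiemannianOn (W : Set F) (G : F → F →L[ℝ] F →L[ℝ] ℝ) : Prop where
  isOpen : IsOpen W
  smooth : ∀ y ∈ W, ContDiffAt ℝ ∞ G y
  inner : ∀ y ∈ W, IsInner (G y)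

theorem fderiv_apply_apply {E : Type*} [NormedAddCommGroup E] [NormedSpace ℝ E]
    {G : E → F →L[ℝ] F →L[ℝ] ℝ} {y : E}
    (hG : DifferentiableAt ℝ G y) (u : E) (v w : F) :
    fderiv ℝ (fun z => G z v w) y u = fderiv ℝ G y u v w := by
  have h1 : HasFDerivAt (fun z => G z v w) _ y :=
    ((hG.hasFDerivAt.clm_apply (hasFDerivAt_const v y)).clm_apply (hasFDerivAt_const w y))
  rw [h1.fderiv]
  simp

theorem koszul_eq_of_compatible {G : F → F →L[ℝ] F →L[ℝ] ℝ} {y : F} {H : F → F → F → ℝ}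
    (hsymm : ∀ u v w, H u v w = H v u w)
    (hc : ∀ u v w, fderiv ℝ G y u v w = H u v w + H u w v) (u v w : F) :
    koszul G y u v w = H u v w := by
  rw [koszul_apply, hc, hc, hc]
  have h1 := hsymm u v w
  have h2 := hsymm u w v
  have h3 := hsymm v w u
  linarith

variable {W : Set F} {G : F → F →L[ℝ] F →L[ℝ] ℝ}

namespace RiemannianOn

variable (hG : RiemannianOn W G) {y : F} (hy : y ∈ W)
include hG hy

theorem mem_nhds : W ∈ 𝓝 y := hG.isOpen.mem_nhds hy

theorem differentiableAt : DifferentiableAt ℝ G y :=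
  (hG.smooth y hy).differentiableAt (by simp)

theorem fderiv_symm (u v w : F) : fderiv ℝ G y u v w = fderiv ℝ G y u w v := by
  rw [← fderiv_apply_apply (hG.differentiableAt hy), ← fderiv_apply_apply (hG.differentiableAt hy)]
  congr 1
  apply Filter.EventuallyEq.fderiv_eq
  filter_upwards [hG.mem_nhds hy] with z hz using (hG.inner z hz).symm v w

variable [FiniteDimensional ℝ F]

theorem inner_christoffel (u v w : F) : G y (christoffel G y u v) w = koszul G y u v w := by
  simp only [christoffel, ContinuousLinearMap.comp_apply, ContinuousLinearMap.compL_apply]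
  rw [(hG.inner y hy).apply_inverse]

theorem christoffel_symm (u v : F) : christoffel G y u v = christoffel G y v u := by
  refine (hG.inner y hy).ext fun w => ?_
  rw [hG.inner_christoffel hy, hG.inner_christoffel hy, koszul_apply, koszul_apply,
    hG.fderiv_symm hy w u v]
  ring

theorem fderiv_eq (u v w : F) :
    fderiv ℝ G y u v w = G y (christoffel G y u v) w + G y v (christoffel G y u w) := by
  rw [(hG.inner y hy).symm v, hG.inner_christoffel hy, hG.inner_christoffel hy, koszul_apply,
    koszul_apply, hG.fderiv_symm hy w u v, hG.fderiv_symm hy u w v, hG.fderiv_symm hy v u w,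
    hG.fderiv_symm hy w v u]
  ring

theorem christoffel_eq_of_compatible {L : F → F → F} (hL : ∀ u v, L u v = L v u)
    (hc : ∀ u v w, fderiv ℝ G y u v w = G y (L u v) w + G y v (L u w)) (u v : F) :
    christoffel G y u v = L u v := by
  refine (hG.inner y hy).ext fun w => ?_
  rw [hG.inner_christoffel hy]
  exact koszul_eq_of_compatible (H := fun u v w => G y (L u v) w) (fun u v w => by simp only [hL u v])
    (fun u v w => by rw [hc, (hG.inner y hy).symm v]) u v w

theorem contDiffAt_inverse : ContDiffAt ℝ ∞ (fun z => (G z).inverse) y := by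
  obtain ⟨e, he⟩ := (hG.inner y hy).isInvertible
  have h1 : ContDiffAt ℝ ∞ ContinuousLinearMap.inverse (G y) := by
    rw [← he]
    exact contDiffAt_map_inverse e
  exact h1.comp y (hG.smooth y hy)

theorem contDiffAt_christoffel : ContDiffAt ℝ ∞ (christoffel G) y := by
  have h1 := hG.contDiffAt_inverse hy
  have h2 : ContDiffAt ℝ ∞ (fderiv ℝ G) y := (hG.smooth y hy).fderiv_right (by simp)
  have h3 : ContDiffAt ℝ ∞ (fun z => (fderiv ℝ G z).flip) y :=
    (ContinuousLinearMap.flipₗᵢ ℝ F F (F →L[ℝ] ℝ)).toContinuousLinearEquiv.contDiff.contDiffAt.comp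
      y h2
  have h4 : ContDiffAt ℝ ∞ (koszul G) y :=
    ((h2.add h3).sub (contDiffAt_const.clm_comp h3)).const_smul (1 / 2 : ℝ)
  exact ((ContinuousLinearMap.compL ℝ F (F →L[ℝ] ℝ) F).contDiff.contDiffAt.comp y h1).clm_comp h4

end RiemannianOn

end LeviCivita

/-! ### Immersions in coordinates -/

section Immersion

variable {k n : ℕ}

/-- `f` is a smooth immersion of the open set `U` into the open set `W`. -/
structure ImmersionOn (U : Set (Euc k)) (W : Set (Euc n)) (f : Euc k → Euc n) : Prop where
  isOpen : IsOpen U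
  smooth : ∀ x ∈ U, ContDiffAt ℝ ∞ f x
  mapsTo : ∀ x ∈ U, f x ∈ W
  injective : ∀ x ∈ U, Function.Injective (fderiv ℝ f x)

variable {U : Set (Euc k)} {W : Set (Euc n)} {f : Euc k → Euc n} {G : FormField n}

theorem induced_apply (G : FormField n) (f : Euc k → Euc n) (x u v : Euc k) :
    induced G f x u v = G (f x) (fderiv ℝ f x u) (fderiv ℝ f x v) := rfl

theorem secondForm_apply (G : FormField n) (f : Euc k → Euc n) (x u v : Euc k) :
    secondForm G f x u v = fderiv ℝ (fderiv ℝ f) x u v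
      + christoffel G (f x) (fderiv ℝ f x u) (fderiv ℝ f x v)
      - fderiv ℝ f x (christoffel (induced G f) x u v) := rfl

theorem two_le_infty : minSmoothness ℝ 2 ≤ (∞ : WithTop ℕ∞) := by
  simp only [minSmoothness_of_isRCLikeNormedField]
  exact WithTop.coe_le_coe.2 (le_top : (2 : ℕ∞) ≤ ⊤)

theorem contDiffAt_flip {E F₁ F₂ F' : Type*} [NormedAddCommGroup E] [NormedSpace ℝ E]
    [NormedAddCommGroup F₁] [NormedSpace ℝ F₁] [NormedAddCommGroup F₂] [NormedSpace ℝ F₂]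
    [NormedAddCommGroup F'] [NormedSpace ℝ F'] {C : E → F₁ →L[ℝ] F₂ →L[ℝ] F'} {x : E}
    (hC : ContDiffAt ℝ ∞ C x) : ContDiffAt ℝ ∞ (fun z => (C z).flip) x :=
  (ContinuousLinearMap.flipₗᵢ ℝ F₁ F₂ F').toContinuousLinearEquiv.contDiff.contDiffAt.comp x hC

theorem contDiffAt_bilinearComp {E F F' : Type*} [NormedAddCommGroup E] [NormedSpace ℝ E]
    [NormedAddCommGroup F] [NormedSpace ℝ F] [NormedAddCommGroup F'] [NormedSpace ℝ F']
    {E' : Type*} [NormedAddCommGroup E'] [NormedSpace ℝ E']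
    {B : E → F →L[ℝ] F →L[ℝ] F'} {L M : E → E' →L[ℝ] F} {x : E}
    (hB : ContDiffAt ℝ ∞ B x) (hL : ContDiffAt ℝ ∞ L x) (hM : ContDiffAt ℝ ∞ M x) :
    ContDiffAt ℝ ∞ (fun z => (B z).bilinearComp (L z) (M z)) x := by
  exact contDiffAt_flip ((contDiffAt_flip (hB.clm_comp hL)).clm_comp hM)

namespace ImmersionOn

variable (hf : ImmersionOn U W f) {x : Euc k} (hx : x ∈ U)
include hf hx

theorem mem_nhds : U ∈ 𝓝 x := hf.isOpen.mem_nhds hx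

theorem contDiffAt_fderiv : ContDiffAt ℝ ∞ (fderiv ℝ f) x :=
  (hf.smooth x hx).fderiv_right (by simp)

theorem hasFDerivAt : HasFDerivAt f (fderiv ℝ f x) x :=
  ((hf.smooth x hx).differentiableAt (by simp)).hasFDerivAt

theorem hasFDerivAt_fderiv : HasFDerivAt (fderiv ℝ f) (fderiv ℝ (fderiv ℝ f) x) x :=
  ((hf.contDiffAt_fderiv hx).differentiableAt (by simp)).hasFDerivAt

theorem fderiv_fderiv_symm (u v : Euc k) :
    fderiv ℝ (fderiv ℝ f) x u v = fderiv ℝ (fderiv ℝ f) x v u :=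
  ((hf.smooth x hx).isSymmSndFDerivAt two_le_infty) u v

theorem contDiffAt_fderiv_apply (u : Euc k) : ContDiffAt ℝ ∞ (fun z => fderiv ℝ f z u) x :=
  (hf.contDiffAt_fderiv hx).clm_apply contDiffAt_const

theorem fderiv_fderiv_apply (u v : Euc k) :
    fderiv ℝ (fun z => fderiv ℝ f z v) x u = fderiv ℝ (fderiv ℝ f) x u v := by
  rw [((hf.hasFDerivAt_fderiv hx).clm_apply (hasFDerivAt_const v x)).fderiv]
  simp

theorem covAlong_fderiv (u v : Euc k) :
    covAlong G f (fun z => fderiv ℝ f z v) x u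
      = fderiv ℝ f x (christoffel (induced G f) x u v) + secondForm G f x u v := by
  rw [covAlong, secondForm_apply, hf.fderiv_fderiv_apply hx]
  abel

theorem fderiv_apply_ne_zero {u : Euc k} (hu : u ≠ 0) : fderiv ℝ f x u ≠ 0 := fun h0 =>
  hu (hf.injective x hx (by rw [h0, map_zero]))

variable (hG : RiemannianOn W G)
include hG

theorem contDiffAt_metric : ContDiffAt ℝ ∞ (fun z => G (f z)) x :=
  (hG.smooth _ (hf.mapsTo x hx)).comp x (hf.smooth x hx)

theorem contDiffAt_christoffel_comp : ContDiffAt ℝ ∞ (fun z => christoffel G (f z)) x :=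
  (hG.contDiffAt_christoffel (hf.mapsTo x hx)).comp x (hf.smooth x hx)

theorem contDiffAt_covAlong {σ : Euc k → Euc n} (hσ : ContDiffAt ℝ ∞ σ x) (u : Euc k) :
    ContDiffAt ℝ ∞ (fun z => covAlong G f σ z u) x :=
  ((hσ.fderiv_right (by simp)).clm_apply contDiffAt_const).add
    (((hf.contDiffAt_christoffel_comp hx hG).clm_apply (hf.contDiffAt_fderiv_apply hx u)).clm_apply
      hσ)

/-- The pullback connection is metric. -/
theorem fderiv_inner {σ τ : Euc k → Euc n} (hσ : DifferentiableAt ℝ σ x)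
    (hτ : DifferentiableAt ℝ τ x) (u : Euc k) :
    fderiv ℝ (fun z => G (f z) (σ z) (τ z)) x u
      = G (f x) (covAlong G f σ x u) (τ x) + G (f x) (σ x) (covAlong G f τ x u) := by
  have hy := hf.mapsTo x hx
  have h1 := (hG.differentiableAt hy).hasFDerivAt.comp x (hf.hasFDerivAt hx)
  have h2 := (h1.clm_apply hσ.hasFDerivAt).clm_apply hτ.hasFDerivAt
  simp only [Function.comp_def] at h2
  rw [h2.fderiv]
  simp only [covAlong, map_add, add_apply,
    ContinuousLinearMap.coe_comp, Function.comp_apply, ContinuousLinearMap.flip_apply]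
  rw [hG.fderiv_eq hy]
  ring

omit hx in
theorem riemannianOn_induced : RiemannianOn U (induced G f) where
  isOpen := hf.isOpen
  smooth _ hx := contDiffAt_bilinearComp (hf.contDiffAt_metric hx hG) (hf.contDiffAt_fderiv hx)
    (hf.contDiffAt_fderiv hx)
  inner x hx :=
    { symm := fun _ _ => (hG.inner _ (hf.mapsTo x hx)).symm _ _
      pos := fun _ hu => (hG.inner _ (hf.mapsTo x hx)).pos _ (hf.fderiv_apply_ne_zero hx hu) }

theorem contDiffAt_secondForm : ContDiffAt ℝ ∞ (secondForm G f) x :=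
  (((hf.contDiffAt_fderiv hx).fderiv_right (by simp)).add
    (contDiffAt_bilinearComp (hf.contDiffAt_christoffel_comp hx hG) (hf.contDiffAt_fderiv hx)
      (hf.contDiffAt_fderiv hx))).sub
    (((ContinuousLinearMap.compL ℝ (Euc k) (Euc k) (Euc n)).contDiff.contDiffAt.comp x
      (hf.contDiffAt_fderiv hx)).clm_comp
        ((hf.riemannianOn_induced hG).contDiffAt_christoffel hx))

theorem secondForm_symm (u v : Euc k) : secondForm G f x u v = secondForm G f x v u := by
  rw [secondForm_apply, secondForm_apply, hf.fderiv_fderiv_symm hx u v,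
    hG.christoffel_symm (hf.mapsTo x hx), (hf.riemannianOn_induced hG).christoffel_symm hx u v]

theorem inner_secondForm (u v w : Euc k) :
    G (f x) (secondForm G f x u v) (fderiv ℝ f x w) = 0 := by
  have hg := hf.riemannianOn_induced hG
  have hy := hf.mapsTo x hx
  have hd : ∀ v, DifferentiableAt ℝ (fun z => fderiv ℝ f z v) x := fun v =>
    (hf.contDiffAt_fderiv_apply hx v).differentiableAt (by simp)
  have h1 : koszul (induced G f) x u v w
      = G (f x) (covAlong G f (fun z => fderiv ℝ f z v) x u) (fderiv ℝ f x w) := by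
    refine koszul_eq_of_compatible
      (H := fun u v w => G (f x) (covAlong G f (fun z => fderiv ℝ f z v) x u) (fderiv ℝ f x w))
      (fun u v w => ?_) (fun u v w => ?_) u v w
    · rw [hf.covAlong_fderiv hx, hf.covAlong_fderiv hx, hf.secondForm_symm hx hG u v,
        hg.christoffel_symm hx u v]
    · rw [← fderiv_apply_apply (hg.differentiableAt hx)]
      simp only [induced_apply]
      rw [hf.fderiv_inner hx hG (hd v) (hd w), (hG.inner _ hy).symm (fderiv ℝ f x v)]
  have h2 := hg.inner_christoffel hx u v w
  rw [h1, hf.covAlong_fderiv hx, induced_apply, map_add, add_apply] at h2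
  linarith

/-- Second covariant derivatives along `f` commute up to curvature. -/
theorem covAlong_commutator {σ : Euc k → Euc n} (hσ : ContDiffAt ℝ ∞ σ x) (u v : Euc k) :
    covAlong G f (fun z => covAlong G f σ z v) x u - covAlong G f (fun z => covAlong G f σ z u) x v
      = curvature G (f x) (fderiv ℝ f x u) (fderiv ℝ f x v) (σ x) := by
  have hy := hf.mapsTo x hx
  have hΓ : HasFDerivAt (christoffel G) (fderiv ℝ (christoffel G) (f x)) (f x) :=
    ((hG.contDiffAt_christoffel hy).differentiableAt (by simp)).hasFDerivAt
  have hσ1 : HasFDerivAt σ (fderiv ℝ σ x) x := (hσ.differentiableAt (by simp)).hasFDerivAt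
  have hσ2 : HasFDerivAt (fderiv ℝ σ) (fderiv ℝ (fderiv ℝ σ) x) x :=
    ((hσ.fderiv_right (m := ∞) (by simp)).differentiableAt (by simp)).hasFDerivAt
  have key : ∀ u v, fderiv ℝ (fun z => covAlong G f σ z v) x u
      = fderiv ℝ (fderiv ℝ σ) x u v
        + (fderiv ℝ (christoffel G) (f x) (fderiv ℝ f x u) (fderiv ℝ f x v) (σ x)
          + christoffel G (f x) (fderiv ℝ (fderiv ℝ f) x u v) (σ x)
          + christoffel G (f x) (fderiv ℝ f x v) (fderiv ℝ σ x u)) := by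
    intro u v
    have h1 := hΓ.comp x (hf.hasFDerivAt hx)
    have h2 := (h1.clm_apply ((hf.hasFDerivAt_fderiv hx).clm_apply
      (hasFDerivAt_const v x))).clm_apply hσ1
    have h3 := (hσ2.clm_apply (hasFDerivAt_const v x)).add h2
    have h4 : HasFDerivAt (fun z => covAlong G f σ z v) _ x := h3
    rw [h4.fderiv]
    simp
    abel
  have hs : fderiv ℝ (fderiv ℝ σ) x u v = fderiv ℝ (fderiv ℝ σ) x v u :=
    (hσ.isSymmSndFDerivAt two_le_infty) u v
  rw [covAlong, key, show covAlong G f (fun z => covAlong G f σ z u) x v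
    = fderiv ℝ (fun z => covAlong G f σ z u) x v
      + christoffel G (f x) (fderiv ℝ f x v) (covAlong G f σ x u) from rfl, key, hs, hf.fderiv_fderiv_symm hx u v]
  simp only [covAlong, curvature, map_add]
  abel

end ImmersionOn

end Immersion

/-! ### Hypersurfaces in coordinates -/

section Forms

variable {k : ℕ}

/-- The covariant derivative `(∇_u b)(v, w)` of a field of bilinear forms. -/
noncomputable def covForm (g b : FormField k) (x u v w : Euc k) : ℝ :=
  fderiv ℝ b x u v w - b x (christoffel g x u v) w - b x v (christoffel g x u w)

theorem covForm_symm {U : Set (Euc k)} {g b : FormField k} {x : Euc k} (hU : U ∈ 𝓝 x)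
    (hb : DifferentiableAt ℝ b x) (hs : ∀ z ∈ U, ∀ u v, b z u v = b z v u) (u v w : Euc k) :
    covForm g b x u v w = covForm g b x u w v := by
  have e : fderiv ℝ b x u v w = fderiv ℝ b x u w v := by
    rw [← fderiv_apply_apply hb, ← fderiv_apply_apply hb]
    congr 1
    apply Filter.EventuallyEq.fderiv_eq
    filter_upwards [hU] with z hz using hs z hz v w
  have hx := mem_of_mem_nhds hU
  rw [covForm, covForm, e, hs x hx _ w, hs x hx v]
  ring

theorem RiemannianOn.formTrace_covForm {U : Set (Euc k)} {g b : FormField k}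
    (hg : RiemannianOn U g) {x : Euc k} (hx : x ∈ U) (hb : ContDiffAt ℝ ∞ b x) (w : Euc k) :
    formTrace (g x) (fun u v => covForm g b x w u v)
      = fderiv ℝ (fun z => formTrace (g z) fun u v => b z u v) x w := by
  set P : Euc k → Euc k →L[ℝ] Euc k := fun z => (g z).inverse ∘L b z with hP
  have hPs : ContDiffAt ℝ ∞ P x := (hg.contDiffAt_inverse hx).clm_comp hb
  have hPd : HasFDerivAt P (fderiv ℝ P x) x := (hPs.differentiableAt (by simp)).hasFDerivAt
  have hbP : ∀ z ∈ U, ∀ u v, b z u v = g z (P z u) v := by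
    intro z hz u v
    simp only [hP, ContinuousLinearMap.comp_apply]
    rw [(hg.inner z hz).apply_inverse]
  have htr : ∀ z ∈ U, formTrace (g z) (fun u v => b z u v)
      = ∑ i, P z (EuclideanSpace.single i 1) i := by
    intro z hz
    simp only [hbP z hz]
    exact formTrace_inner_comp (hg.inner z hz) _
  have hrhs : fderiv ℝ (fun z => formTrace (g z) fun u v => b z u v) x w
      = ∑ i, fderiv ℝ P x w (EuclideanSpace.single i 1) i := by
    have h1 : (fun z => formTrace (g z) fun u v => b z u v) =ᶠ[𝓝 x]
        fun z => ∑ i, (EuclideanSpace.proj i : Euc k →L[ℝ] ℝ) (P z (EuclideanSpace.single i 1)) := by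
      filter_upwards [hg.mem_nhds hx] with z hz using htr z hz
    rw [h1.fderiv_eq]
    have h2 : HasFDerivAt (fun z => ∑ i, (EuclideanSpace.proj i : Euc k →L[ℝ] ℝ)
        (P z (EuclideanSpace.single i 1))) _ x :=
      HasFDerivAt.fun_sum fun i _ => (EuclideanSpace.proj i : Euc k →L[ℝ] ℝ).hasFDerivAt.comp x
        (hPd.clm_apply (hasFDerivAt_const (EuclideanSpace.single i (1 : ℝ)) x))
    rw [h2.fderiv]
    simp
  have hdb : ∀ u v, fderiv ℝ b x w u v
      = fderiv ℝ g x w (P x u) v + g x (fderiv ℝ P x w u) v := by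
    intro u v
    rw [← fderiv_apply_apply (hb.differentiableAt (by simp))]
    have h1 : (fun z => b z u v) =ᶠ[𝓝 x] fun z => g z (P z u) v := by
      filter_upwards [hg.mem_nhds hx] with z hz using hbP z hz u v
    rw [h1.fderiv_eq]
    have h2 : HasFDerivAt (fun z => g z (P z u) v) _ x :=
      ((hg.differentiableAt hx).hasFDerivAt.clm_apply
        (hPd.clm_apply (hasFDerivAt_const u x))).clm_apply (hasFDerivAt_const v x)
    rw [h2.fderiv]
    simp
    ring
  have hcov : ∀ u v, covForm g b x w u v = g x ((fderiv ℝ P x w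
      + (christoffel g x w ∘L P x - P x ∘L christoffel g x w)) u) v := by
    intro u v
    rw [covForm, hdb, hg.fderiv_eq hx, hbP x hx, hbP x hx]
    simp
    ring
  simp only [hcov]
  rw [formTrace_inner_comp (hg.inner x hx), hrhs]
  simp [Finset.sum_add_distrib, sum_comp_comm (christoffel g x w) (P x)]

end Forms

section Hypersurface

variable {k : ℕ}

/-- `N` is a smooth normal field of constant squared length `ρ` along `f`. -/
structure NormalOn (U : Set (Euc k)) (G : FormField (k + 1)) (f N : Euc k → Euc (k + 1)) (ρ : ℝ) :
    Prop where
  smooth : ∀ x ∈ U, ContDiffAt ℝ ∞ N x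
  normal : ∀ x ∈ U, ∀ u, G (f x) (N x) (fderiv ℝ f x u) = 0
  norm : ∀ x ∈ U, G (f x) (N x) (N x) = ρ
  pos : 0 < ρ

/-- The scalar second fundamental form `b(u, v) = G(N, B(u, v))`. -/
noncomputable def scalarForm (G : FormField (k + 1)) (f N : Euc k → Euc (k + 1)) : FormField k :=
  fun x => ContinuousLinearMap.compL ℝ (Euc k) (Euc (k + 1)) ℝ (G (f x) (N x)) ∘L secondForm G f x

theorem scalarForm_apply (G : FormField (k + 1)) (f N : Euc k → Euc (k + 1)) (x u v : Euc k) :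
    scalarForm G f N x u v = G (f x) (N x) (secondForm G f x u v) := rfl

variable {U : Set (Euc k)} {W : Set (Euc (k + 1))} {f N : Euc k → Euc (k + 1)}
  {G : FormField (k + 1)} {ρ : ℝ}

namespace NormalOn

variable (hN : NormalOn U G f N ρ) (hf : ImmersionOn U W f) (hG : RiemannianOn W G)
  {x : Euc k} (hx : x ∈ U)

include hN hx in
theorem differentiableAt : DifferentiableAt ℝ N x := (hN.smooth x hx).differentiableAt (by simp)

include hf hG hx in
theorem scalarForm_symm (u v : Euc k) : scalarForm G f N x u v = scalarForm G f N x v u := by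
  rw [scalarForm_apply, scalarForm_apply, hf.secondForm_symm hx hG]

include hN hf hx

theorem inner_covAlong_fderiv (u v : Euc k) :
    G (f x) (N x) (covAlong G f (fun z => fderiv ℝ f z v) x u) = scalarForm G f N x u v := by
  rw [hf.covAlong_fderiv hx, map_add, hN.normal x hx, zero_add, scalarForm_apply]

theorem exists_decomp (y : Euc (k + 1)) : ∃ (u : Euc k) (t : ℝ), y = fderiv ℝ f x u + t • N x := by
  let L : (Euc k × ℝ) →ₗ[ℝ] Euc (k + 1) :=
    (fderiv ℝ f x : Euc k →ₗ[ℝ] Euc (k + 1)).coprod (LinearMap.toSpanSingleton ℝ _ (N x))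
  have hL : ∀ p, L p = fderiv ℝ f x p.1 + p.2 • N x := fun p => by simp [L]
  have hinj : Function.Injective L := by
    rw [← LinearMap.ker_eq_bot, LinearMap.ker_eq_bot']
    rintro ⟨u, t⟩ h0
    rw [hL] at h0
    have h1 := congrArg (G (f x) (N x)) h0
    simp only [map_add, hN.normal x hx, map_smul, hN.norm x hx, smul_eq_mul, map_zero,
      zero_add] at h1
    have ht : t = 0 := (mul_eq_zero.1 h1).resolve_right hN.pos.ne'
    subst ht
    simp only [zero_smul, add_zero] at h0
    have : u = 0 := hf.injective x hx (by rw [h0, map_zero])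
    simp [this]
  have hsurj : Function.Surjective L :=
    (LinearMap.injective_iff_surjective_of_finrank_eq_finrank (by simp)).1 hinj
  obtain ⟨p, hp⟩ := hsurj y
  exact ⟨p.1, p.2, by rw [← hp, hL]⟩

theorem exists_tangent {y : Euc (k + 1)} (hy : G (f x) (N x) y = 0) : ∃ u, fderiv ℝ f x u = y := by
  obtain ⟨u, t, rfl⟩ := hN.exists_decomp hf hx y
  simp only [map_add, hN.normal x hx, map_smul, hN.norm x hx, smul_eq_mul, zero_add] at hy
  have ht : t = 0 := (mul_eq_zero.1 hy).resolve_right hN.pos.ne'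
  exact ⟨u, by simp [ht]⟩

include hG

theorem eq_smul_of_normal {y : Euc (k + 1)} (hy : ∀ u, G (f x) y (fderiv ℝ f x u) = 0) :
    y = (G (f x) (N x) y / ρ) • N x := by
  obtain ⟨u, t, rfl⟩ := hN.exists_decomp hf hx y
  have h1 := hy u
  have hu : u = 0 := by
    refine ((hf.riemannianOn_induced hG).inner x hx).eq_zero ?_
    simpa [induced_apply, hN.normal x hx] using h1
  simp [hu, hN.norm x hx, hN.pos.ne']

theorem secondForm_eq (u v : Euc k) :
    secondForm G f x u v = (scalarForm G f N x u v / ρ) • N x :=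
  hN.eq_smul_of_normal hf hG hx fun w => hf.inner_secondForm hx hG u v w

theorem contDiffAt_scalarForm : ContDiffAt ℝ ∞ (scalarForm G f N) x :=
  ((ContinuousLinearMap.compL ℝ (Euc k) (Euc (k + 1)) ℝ).contDiff.contDiffAt.comp x
    ((hf.contDiffAt_metric hx hG).clm_apply (hN.smooth x hx))).clm_comp
      (hf.contDiffAt_secondForm hx hG)

theorem inner_covAlong_self (u : Euc k) : G (f x) (covAlong G f N x u) (N x) = 0 := by
  have h1 := hf.fderiv_inner hx hG (hN.differentiableAt hx) (hN.differentiableAt hx) u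
  have h2 : (fun z => G (f z) (N z) (N z)) =ᶠ[𝓝 x] fun _ => ρ := by
    filter_upwards [hf.mem_nhds hx] with z hz using hN.norm z hz
  rw [h2.fderiv_eq, fderiv_const_apply, (hG.inner _ (hf.mapsTo x hx)).symm (N x)] at h1
  simp at h1
  linarith

/-- For a normal field `σ`, `G(∇_u σ, df w) = -G(σ, B(u, w))`. -/
theorem inner_covAlong_tangent (u w : Euc k) :
    G (f x) (covAlong G f N x u) (fderiv ℝ f x w) = -scalarForm G f N x u w := by
  have h1 := hf.fderiv_inner hx hG (hN.differentiableAt hx)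
    ((hf.contDiffAt_fderiv_apply hx w).differentiableAt (by simp)) u
  have h2 : (fun z => G (f z) (N z) (fderiv ℝ f z w)) =ᶠ[𝓝 x] fun _ => 0 := by
    filter_upwards [hf.mem_nhds hx] with z hz using hN.normal z hz w
  rw [h2.fderiv_eq, fderiv_const_apply, hN.inner_covAlong_fderiv hf hx] at h1
  simp at h1
  linarith

theorem inner_covAlong_secondForm (u v w : Euc k) :
    G (f x) (covAlong G f N x u) (secondForm G f x v w) = 0 := by
  rw [hN.secondForm_eq hf hG hx, map_smul, hN.inner_covAlong_self hf hG hx, smul_zero]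

/-- The Codazzi equation. -/
theorem codazzi (u v w : Euc k) :
    covForm (induced G f) (scalarForm G f N) x u v w
        - covForm (induced G f) (scalarForm G f N) x v u w
      = G (f x) (N x)
        (curvature G (f x) (fderiv ℝ f x u) (fderiv ℝ f x v) (fderiv ℝ f x w)) := by
  have hs : ∀ w, ContDiffAt ℝ ∞ (fun z => fderiv ℝ f z w) x := hf.contDiffAt_fderiv_apply hx
  have key : ∀ u v w, fderiv ℝ (scalarForm G f N) x u v w
      = -scalarForm G f N x u (christoffel (induced G f) x v w)
        + G (f x) (N x) (covAlong G f
          (fun z => covAlong G f (fun z => fderiv ℝ f z w) z v) x u) := by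
    intro u v w
    rw [← fderiv_apply_apply ((hN.contDiffAt_scalarForm hf hG hx).differentiableAt (by simp))]
    have h1 : (fun z => scalarForm G f N z v w) =ᶠ[𝓝 x]
        fun z => G (f z) (N z) (covAlong G f (fun z => fderiv ℝ f z w) z v) := by
      filter_upwards [hf.mem_nhds hx] with z hz using (hN.inner_covAlong_fderiv hf hz v w).symm
    rw [h1.fderiv_eq, hf.fderiv_inner hx hG (hN.differentiableAt hx)
      ((hf.contDiffAt_covAlong hx hG (hs w) v).differentiableAt (by simp)),
      hf.covAlong_fderiv hx v w, map_add, hN.inner_covAlong_tangent hf hG hx,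
      hN.inner_covAlong_secondForm hf hG hx, add_zero]
  rw [← hf.covAlong_commutator hx hG (hs w) u v, map_sub, covForm, covForm, key, key,
    (hf.riemannianOn_induced hG).christoffel_symm hx u v]
  ring

variable {h : Euc k → ℝ} (hh : ∀ x ∈ U, ContDiffAt ℝ ∞ h x)
include hh

omit hf hG in
theorem covAlong_smul (u : Euc k) :
    covAlong G f (fun z => h z • N z) x u = fderiv ℝ h x u • N x + h x • covAlong G f N x u := by
  have h1 : HasFDerivAt (fun z => h z • N z) _ x :=
    ((hh x hx).differentiableAt (by simp)).hasFDerivAt.smul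
      (hN.differentiableAt hx).hasFDerivAt
  rw [covAlong, h1.fderiv]
  simp [covAlong]
  abel

/-- The tangential part of the second covariant derivative of the normal field `h N`. -/
theorem inner_covAlong₂ (u v w : Euc k) :
    G (f x) (covAlong₂ G f (fun z => h z • N z) x u v) (fderiv ℝ f x w)
      = -(fderiv ℝ h x u * scalarForm G f N x v w)
        - h x * covForm (induced G f) (scalarForm G f N) x u v w
        - fderiv ℝ h x v * scalarForm G f N x u w := by
  set σ : Euc k → Euc (k + 1) := fun z => h z • N z with hσ
  have hσs : ∀ z ∈ U, ContDiffAt ℝ ∞ σ z := fun z hz => (hh z hz).smul (hN.smooth z hz)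
  have htan : ∀ z ∈ U, ∀ v w, G (f z) (covAlong G f σ z v) (fderiv ℝ f z w)
      = -(h z * scalarForm G f N z v w) := by
    intro z hz v w
    rw [hN.covAlong_smul hz hh, map_add, add_apply, map_smul, map_smul]
    simp [hN.normal z hz, hN.inner_covAlong_tangent hf hG hz]
  have hb := (hN.contDiffAt_scalarForm hf hG hx).differentiableAt (by simp)
  have h1 : fderiv ℝ (fun z => G (f z) (covAlong G f σ z v) (fderiv ℝ f z w)) x u
      = -(fderiv ℝ h x u * scalarForm G f N x v w
        + h x * fderiv ℝ (scalarForm G f N) x u v w) := by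
    have e : (fun z => G (f z) (covAlong G f σ z v) (fderiv ℝ f z w)) =ᶠ[𝓝 x]
        fun z => -(h z * scalarForm G f N z v w) := by
      filter_upwards [hf.mem_nhds hx] with z hz using htan z hz v w
    rw [e.fderiv_eq]
    have h2 : HasFDerivAt (fun z => -(h z * scalarForm G f N z v w)) _ x :=
      (((hh x hx).differentiableAt (by simp)).hasFDerivAt.mul
        ((hb.hasFDerivAt.clm_apply (hasFDerivAt_const v x)).clm_apply (hasFDerivAt_const w x))).neg
    rw [h2.fderiv]
    simp
    ring
  rw [hf.fderiv_inner hx hG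
    ((hf.contDiffAt_covAlong hx hG (hσs x hx) v).differentiableAt (by simp))
    ((hf.contDiffAt_fderiv_apply hx w).differentiableAt (by simp)), hf.covAlong_fderiv hx,
    map_add, htan x hx] at h1
  have h3 : G (f x) (covAlong G f σ x v) (secondForm G f x u w)
      = fderiv ℝ h x v * scalarForm G f N x u w := by
    rw [hN.covAlong_smul hx hh, map_add, add_apply, map_smul, map_smul]
    simp [hN.inner_covAlong_secondForm hf hG hx, scalarForm_apply]
  rw [h3] at h1
  rw [covAlong₂, map_sub, sub_apply, htan x hx, covForm]
  linarith

/-- The tangential part of the trace of the second covariant derivative of `h N`. -/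
theorem inner_metricTrace_covAlong₂ (w : Euc k) :
    G (f x) (metricTrace (induced G f x) (covAlong₂ G f (fun z => h z • N z) x)) (fderiv ℝ f x w)
      = -2 * scalarForm G f N x ((induced G f x).inverse (fderiv ℝ h x)) w
        - h x * fderiv ℝ (fun z => formTrace (induced G f z) fun u v => scalarForm G f N z u v) x w
        - h x * formTrace (induced G f x) (fun u v => G (f x) (N x)
          (curvature G (f x) (fderiv ℝ f x u) (fderiv ℝ f x w) (fderiv ℝ f x v))) := by
  have hg := hf.riemannianOn_induced hG
  have hb := hN.contDiffAt_scalarForm hf hG hx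
  have hcs := covForm_symm (g := induced G f) (hf.mem_nhds hx) (hb.differentiableAt (by simp))
    fun z hz => scalarForm_symm hf hG hz
  have hterm : ∀ u v, G (f x) (covAlong₂ G f (fun z => h z • N z) x u v) (fderiv ℝ f x w)
      = -(fderiv ℝ h x u * (scalarForm G f N x).flip w v)
        - h x * (covForm (induced G f) (scalarForm G f N) x w u v
          + G (f x) (N x)
            (curvature G (f x) (fderiv ℝ f x u) (fderiv ℝ f x w) (fderiv ℝ f x v)))
        - (scalarForm G f N x).flip w u * fderiv ℝ h x v := by
    intro u v
    rw [hN.inner_covAlong₂ hf hG hx hh, hcs u v w, ← hN.codazzi hf hG hx u w v]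
    simp only [ContinuousLinearMap.flip_apply]
    ring
  have hflip := formTrace_flip (hg.inner x hx)
    ((fderiv ℝ h x).smulRight ((scalarForm G f N x).flip w))
  have h1 : formTrace (induced G f x)
      (fun u v => fderiv ℝ h x u * (scalarForm G f N x).flip w v)
      = scalarForm G f N x ((induced G f x).inverse (fderiv ℝ h x)) w := by
    rw [formTrace_mul_apply, ContinuousLinearMap.flip_apply]
  have h2 : formTrace (induced G f x)
      (fun u v => (scalarForm G f N x).flip w u * fderiv ℝ h x v)
      = scalarForm G f N x ((induced G f x).inverse (fderiv ℝ h x)) w := by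
    rw [← h1]
    simpa [mul_comm] using hflip
  rw [(hG.inner _ (hf.mapsTo x hx)).symm, map_metricTrace]
  simp only [(hG.inner _ (hf.mapsTo x hx)).symm (fderiv ℝ f x w), hterm]
  rw [formTrace_sub, formTrace_sub, formTrace_neg, formTrace_mul, formTrace_add, h1, h2,
    hg.formTrace_covForm hx hb]
  ring

end NormalOn

end Hypersurface

/-! ### The intrinsic geometry of a pseudo-Hopf hypersurface -/

section Intrinsic

variable {k : ℕ}

/-- The covariant derivative of the vector field dual to the form `a`. -/
theorem RiemannianOn.inner_cov_sharp {U : Set (Euc k)} {g : FormField k} (hg : RiemannianOn U g)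
    {a : Euc k → Euc k →L[ℝ] ℝ} {x : Euc k} (hx : x ∈ U) (ha : ContDiffAt ℝ ∞ a x) (u w : Euc k) :
    g x (fderiv ℝ (fun z => (g z).inverse (a z)) x u
      + christoffel g x u ((g x).inverse (a x))) w
      = fderiv ℝ a x u w - a x (christoffel g x u w) := by
  have hV := (((hg.contDiffAt_inverse hx).clm_apply ha).differentiableAt (by simp)).hasFDerivAt
  have h1 : HasFDerivAt (fun z => g z ((g z).inverse (a z)) w) _ x :=
    ((hg.differentiableAt hx).hasFDerivAt.clm_apply hV).clm_apply (hasFDerivAt_const w x)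
  have h2 : HasFDerivAt (fun z => a z w) _ x :=
    (ha.differentiableAt (by simp)).hasFDerivAt.clm_apply (hasFDerivAt_const w x)
  have e : (fun z => g z ((g z).inverse (a z)) w) =ᶠ[𝓝 x] fun z => a z w := by
    filter_upwards [hg.mem_nhds hx] with z hz
    rw [(hg.inner z hz).apply_inverse]
  have h3 := congrArg (fun L : Euc k →L[ℝ] ℝ => L u) e.fderiv_eq
  simp only [h1.fderiv, h2.fderiv] at h3
  simp at h3
  rw [hg.fderiv_eq hx, (hg.inner x hx).apply_inverse] at h3
  rw [map_add, add_apply]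
  linarith

/-- The tensor fields induced on a pseudo-Hopf hypersurface of a Sasakian space form: the metric
`g`, the second fundamental form `b`, the form `Φ(u, v) = g(φu, v)`, the forms `η = g(ξ, ·)` and
`ν = g(V, ·)`. The function `h` is a solution of the tangential part of the Ricci-biharmonic
equation. -/
structure PseudoHopfData (U : Set (Euc k)) (g b Φ : FormField k) (η ν : Euc k → Euc k →L[ℝ] ℝ)
    (h : Euc k → ℝ) (c α β r : ℝ) : Prop where
  metric : RiemannianOn U g
  smooth_b : ∀ x ∈ U, ContDiffAt ℝ ∞ b x
  smooth_η : ∀ x ∈ U, ContDiffAt ℝ ∞ η x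
  smooth_ν : ∀ x ∈ U, ContDiffAt ℝ ∞ ν x
  smooth_h : ∀ x ∈ U, ContDiffAt ℝ ∞ h x
  b_symm : ∀ x ∈ U, ∀ u v, b x u v = b x v u
  Φ_skew : ∀ x ∈ U, ∀ u v, Φ x u v = -Φ x v u
  η_V : ∀ x ∈ U, η x ((g x).inverse (ν x)) = 0
  ν_V : ∀ x ∈ U, ν x ((g x).inverse (ν x)) = 1
  η_ζ : ∀ x ∈ U, η x ((g x).inverse (η x)) = 1
  Φ_V : ∀ x ∈ U, ∀ u, Φ x u ((g x).inverse (ν x)) = 0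
  Φ_ζ : ∀ x ∈ U, ∀ u, Φ x u ((g x).inverse (η x)) = 0
  Φ_nondeg : ∀ x ∈ U, ∀ w, (∀ u, Φ x u w = 0) → η x w = 0 → ν x w = 0 → w = 0
  cov_η : ∀ x ∈ U, ∀ u w, fderiv ℝ η x u w - η x (christoffel g x u w) = -Φ x u w
  cov_ν : ∀ x ∈ U, ∀ u w, fderiv ℝ ν x u w - ν x (christoffel g x u w)
    = Φ x ((g x).inverse (b x u)) w
  b_ζ : ∀ x ∈ U, ∀ w, b x ((g x).inverse (η x)) w = -ν x w
  b_V : ∀ x ∈ U, ∀ w, b x ((g x).inverse (ν x)) w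
    = -η x w + b x ((g x).inverse (ν x)) ((g x).inverse (ν x)) * ν x w
  codazzi : ∀ x ∈ U, ∀ u v w, covForm g b x u v w - covForm g b x v u w
    = -((c - 1) / 4) * (Φ x u w * ν x v + 2 * Φ x u v * ν x w - Φ x v w * ν x u)
  tangential : ∀ x ∈ U, ∀ w, b x ((g x).inverse (fderiv ℝ h x)) w
    - β / α * fderiv ℝ h x ((g x).inverse (ν x)) * η x w = -(r * h x * fderiv ℝ h x w)
  h_pos : ∀ x ∈ U, 0 < h x
  h_ne : ∀ x ∈ U, fderiv ℝ h x ≠ 0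
  α_pos : 0 < α
  r_pos : 0 < r
  c_pos : 0 < c + 3
  add_eq : α + β = 2 * r

namespace PseudoHopfData

variable {U : Set (Euc k)} {g b Φ : FormField k} {η ν : Euc k → Euc k →L[ℝ] ℝ}
  {h : Euc k → ℝ} {c α β r : ℝ} (D : PseudoHopfData U g b Φ η ν h c α β r)

theorem weingarten_inner {U : Set (Euc k)} {g b : FormField k} (hg : RiemannianOn U g)
    {x : Euc k} (hx : x ∈ U) (u w : Euc k) :
    g x w ((g x).inverse (b x u)) = b x u w :=
  (hg.inner x hx).apply_inverse_right _ _

section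

variable {x : Euc k} (hx : x ∈ U)
include D hx

theorem contDiffAt_V : ContDiffAt ℝ ∞ (fun z => (g z).inverse (ν z)) x :=
  (D.metric.contDiffAt_inverse hx).clm_apply (D.smooth_ν x hx)

theorem contDiffAt_δ :
    ContDiffAt ℝ ∞ (fun z => b z ((g z).inverse (ν z)) ((g z).inverse (ν z))) x :=
  ((D.smooth_b x hx).clm_apply (D.contDiffAt_V hx)).clm_apply (D.contDiffAt_V hx)

theorem ν_ζ : ν x ((g x).inverse (η x)) = 0 := by
  rw [(D.metric.inner x hx).apply_inverse_comm, D.η_V x hx]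

/-- `∇_u V = φAu`, tangentially. -/
theorem inner_cov_V (u w : Euc k) :
    g x (fderiv ℝ (fun z => (g z).inverse (ν z)) x u
      + christoffel g x u ((g x).inverse (ν x))) w = Φ x ((g x).inverse (b x u)) w := by
  rw [D.metric.inner_cov_sharp hx (D.smooth_ν x hx), D.cov_ν x hx]

theorem covForm_V (u w : Euc k) :
    covForm g b x u ((g x).inverse (ν x)) w
      = -Φ x ((g x).inverse (b x u)) ((g x).inverse (b x w)) + Φ x u w
        + fderiv ℝ (fun z => b z ((g z).inverse (ν z)) ((g z).inverse (ν z))) x u * ν x w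
        + b x ((g x).inverse (ν x)) ((g x).inverse (ν x)) * Φ x ((g x).inverse (b x u)) w := by
  have hV := ((D.contDiffAt_V hx).differentiableAt (by simp)).hasFDerivAt
  have hδ := ((D.contDiffAt_δ hx).differentiableAt (by simp)).hasFDerivAt
  have hν := ((D.smooth_ν x hx).differentiableAt (by simp)).hasFDerivAt
  have hη := ((D.smooth_η x hx).differentiableAt (by simp)).hasFDerivAt
  have hb := ((D.smooth_b x hx).differentiableAt (by simp)).hasFDerivAt
  set δ : Euc k → ℝ := fun z => b z ((g z).inverse (ν z)) ((g z).inverse (ν z)) with hδdef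
  have h1 : HasFDerivAt (fun z => b z ((g z).inverse (ν z)) w) _ x :=
    (hb.clm_apply hV).clm_apply (hasFDerivAt_const w x)
  have h2 : HasFDerivAt (fun z => -η z w + δ z * ν z w) _ x :=
    (hη.clm_apply (hasFDerivAt_const w x)).neg.add (hδ.mul (hν.clm_apply (hasFDerivAt_const w x)))
  have e : (fun z => b z ((g z).inverse (ν z)) w) =ᶠ[𝓝 x] fun z => -η z w + δ z * ν z w := by
    filter_upwards [D.metric.mem_nhds hx] with z hz using D.b_V z hz w
  have h3 := congrArg (fun L : Euc k →L[ℝ] ℝ => L u) e.fderiv_eq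
  simp only [h1.fderiv, h2.fderiv] at h3
  simp at h3
  have h4 : b x (fderiv ℝ (fun z => (g z).inverse (ν z)) x u
      + christoffel g x u ((g x).inverse (ν x))) w
      = Φ x ((g x).inverse (b x u)) ((g x).inverse (b x w)) := by
    rw [D.b_symm x hx, ← weingarten_inner D.metric hx w, D.inner_cov_V hx]
  have h5 := D.b_V x hx (christoffel g x u w)
  have h6 := D.cov_η x hx u w
  have h7 := D.cov_ν x hx u w
  rw [map_add, add_apply] at h4
  change _ = _ + δ x * _ at h5
  change _ = _ + _ + _ + δ x * _
  rw [covForm, ← h7]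
  linear_combination h3 - h4 - h5 - h6

theorem covForm_symm (u v w : Euc k) : covForm g b x u v w = covForm g b x u w v :=
  RicciBiharmonic.covForm_symm (D.metric.mem_nhds hx)
    ((D.smooth_b x hx).differentiableAt (by simp)) D.b_symm u v w

/-- The Hopf-type identity obtained from the Codazzi equation in the direction `V`. -/
theorem hopf_identity (u w : Euc k) :
    2 * Φ x ((g x).inverse (b x u)) ((g x).inverse (b x w))
      = b x ((g x).inverse (ν x)) ((g x).inverse (ν x))
          * (Φ x ((g x).inverse (b x u)) w + Φ x u ((g x).inverse (b x w)))
        + (c + 3) / 2 * Φ x u w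
        + fderiv ℝ (fun z => b z ((g z).inverse (ν z)) ((g z).inverse (ν z))) x u * ν x w
        - fderiv ℝ (fun z => b z ((g z).inverse (ν z)) ((g z).inverse (ν z))) x w * ν x u := by
  have h1 := D.codazzi x hx u w ((g x).inverse (ν x))
  rw [D.covForm_symm hx u, D.covForm_symm hx w, D.covForm_V hx, D.covForm_V hx, D.Φ_V x hx,
    D.Φ_V x hx, D.ν_V x hx] at h1
  have h2 := D.Φ_skew x hx ((g x).inverse (b x w)) ((g x).inverse (b x u))
  have h3 := D.Φ_skew x hx w u
  have h4 := D.Φ_skew x hx ((g x).inverse (b x w)) u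
  rw [h2, h3, h4] at h1
  linear_combination -h1

theorem fderiv_δ (u : Euc k) :
    fderiv ℝ (fun z => b z ((g z).inverse (ν z)) ((g z).inverse (ν z))) x u
      = fderiv ℝ (fun z => b z ((g z).inverse (ν z)) ((g z).inverse (ν z))) x
        ((g x).inverse (ν x)) * ν x u := by
  have h1 := D.hopf_identity hx u ((g x).inverse (ν x))
  have h2 : ∀ v, Φ x v ((g x).inverse (b x ((g x).inverse (ν x)))) = 0 := by
    intro v
    have e : b x ((g x).inverse (ν x)) = -η x
        + b x ((g x).inverse (ν x)) ((g x).inverse (ν x)) • ν x := by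
      ext w
      simpa using D.b_V x hx w
    rw [e, map_add, map_neg, map_smul]
    simp [D.Φ_ζ x hx, D.Φ_V x hx]
  rw [h2, h2, D.Φ_V x hx, D.Φ_V x hx, D.ν_V x hx] at h1
  linarith

theorem tangential_ζ : 2 * fderiv ℝ h x ((g x).inverse (ν x))
    = α * h x * fderiv ℝ h x ((g x).inverse (η x)) := by
  have h1 := D.tangential x hx ((g x).inverse (η x))
  rw [D.η_ζ x hx, D.b_symm x hx, D.b_ζ x hx, (D.metric.inner x hx).apply_inverse_comm (ν x)] at h1
  have hα := D.α_pos.ne'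
  have hβ : β = 2 * r - α := by linarith [D.add_eq]
  rw [hβ] at h1
  field_simp at h1
  have h2 : r * (2 * fderiv ℝ h x ((g x).inverse (ν x))
      - α * h x * fderiv ℝ h x ((g x).inverse (η x))) = 0 := by linarith
  linarith [(mul_eq_zero.1 h2).resolve_left D.r_pos.ne']

theorem tangential_V : -fderiv ℝ h x ((g x).inverse (η x))
    + b x ((g x).inverse (ν x)) ((g x).inverse (ν x)) * fderiv ℝ h x ((g x).inverse (ν x))
    = -(r * h x * fderiv ℝ h x ((g x).inverse (ν x))) := by
  have h1 := D.tangential x hx ((g x).inverse (ν x))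
  rw [D.η_V x hx, D.b_symm x hx, D.b_V x hx, (D.metric.inner x hx).apply_inverse_comm (ν x),
    (D.metric.inner x hx).apply_inverse_comm (η x)] at h1
  linarith

theorem hasFDerivAt_h : HasFDerivAt h (fderiv ℝ h x) x :=
  ((D.smooth_h x hx).differentiableAt (by simp)).hasFDerivAt

theorem contDiffAt_fderiv_h : ContDiffAt ℝ ∞ (fderiv ℝ h) x :=
  (D.smooth_h x hx).fderiv_right (by simp)

/-- `V(h) = 0`. -/
theorem fderiv_h_V : fderiv ℝ h x ((g x).inverse (ν x)) = 0 := by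
  by_contra hne
  have hcont : ContinuousAt (fun z => fderiv ℝ h z ((g z).inverse (ν z))) x :=
    ((D.contDiffAt_fderiv_h hx).clm_apply (D.contDiffAt_V hx)).continuousAt
  have hev : ∀ᶠ z in 𝓝 x, α * (h z * b z ((g z).inverse (ν z)) ((g z).inverse (ν z)))
      + α * r * (h z * h z) = 2 := by
    filter_upwards [hcont.eventually_ne hne, D.metric.mem_nhds hx] with z hz hzU
    have h1 := D.tangential_ζ hzU
    have h2 := D.tangential_V hzU
    refine mul_right_cancel₀ hz ?_
    linear_combination α * h z * h2 - h1
  have hδ := ((D.contDiffAt_δ hx).differentiableAt (by simp)).hasFDerivAt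
  have hx2 := hev.self_of_nhds
  have hδζ := D.fderiv_δ hx ((g x).inverse (η x))
  rw [D.ν_ζ hx, mul_zero] at hδζ
  set δ : Euc k → ℝ := fun z => b z ((g z).inverse (ν z)) ((g z).inverse (ν z)) with hδdef
  have hh := D.hasFDerivAt_h hx
  have h1 : HasFDerivAt (fun z => α * (h z * δ z) + α * r * (h z * h z)) _ x :=
    ((hh.mul hδ).const_mul α).add ((hh.mul hh).const_mul (α * r))
  have e : (fun z => α * (h z * δ z) + α * r * (h z * h z)) =ᶠ[𝓝 x] fun _ => 2 := hev
  have h3 := congrArg (fun L : Euc k →L[ℝ] ℝ => L ((g x).inverse (η x))) e.fderiv_eq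
  simp only [h1.fderiv] at h3
  simp [hδζ] at h3
  change α * (h x * δ x) + _ = 2 at hx2
  have hpos := D.h_pos x hx
  have hα := D.α_pos
  have hr := D.r_pos
  have h4 : (2 + α * r * (h x * h x)) * fderiv ℝ h x ((g x).inverse (η x)) = 0 := by
    linear_combination h x * h3 - fderiv ℝ h x ((g x).inverse (η x)) * hx2
  have h5 : fderiv ℝ h x ((g x).inverse (η x)) = 0 :=
    (mul_eq_zero.1 h4).resolve_left (by positivity)
  have h6 := D.tangential_ζ hx
  rw [h5] at h6
  exact hne (by linarith)

theorem b_grad (w : Euc k) : b x ((g x).inverse (fderiv ℝ h x)) w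
    = -(r * h x) * fderiv ℝ h x w := by
  have h1 := D.tangential x hx w
  rw [D.fderiv_h_V hx] at h1
  linarith

theorem weingarten_grad : (g x).inverse (b x ((g x).inverse (fderiv ℝ h x)))
    = -(r * h x) • (g x).inverse (fderiv ℝ h x) := by
  have e : b x ((g x).inverse (fderiv ℝ h x)) = -(r * h x) • fderiv ℝ h x := by
    ext w
    simpa using D.b_grad hx w
  rw [e, map_smul]

theorem hess_V (w : Euc k) :
    fderiv ℝ (fderiv ℝ h) x ((g x).inverse (ν x)) w
        - fderiv ℝ h x (christoffel g x ((g x).inverse (ν x)) w)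
      = -Φ x ((g x).inverse (b x w)) ((g x).inverse (fderiv ℝ h x)) := by
  have hV := ((D.contDiffAt_V hx).differentiableAt (by simp)).hasFDerivAt
  have hd := ((D.contDiffAt_fderiv_h hx).differentiableAt (by simp)).hasFDerivAt
  have h1 : HasFDerivAt (fun z => fderiv ℝ h z ((g z).inverse (ν z))) _ x := hd.clm_apply hV
  have e : (fun z => fderiv ℝ h z ((g z).inverse (ν z))) =ᶠ[𝓝 x] fun _ => 0 := by
    filter_upwards [D.metric.mem_nhds hx] with z hz using D.fderiv_h_V hz
  have h3 := congrArg (fun L : Euc k →L[ℝ] ℝ => L w) e.fderiv_eq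
  simp only [h1.fderiv] at h3
  simp at h3
  have h4 := D.inner_cov_V hx w ((g x).inverse (fderiv ℝ h x))
  rw [(D.metric.inner x hx).apply_inverse_right, map_add] at h4
  have h5 : fderiv ℝ (fderiv ℝ h) x ((g x).inverse (ν x)) w
      = fderiv ℝ (fderiv ℝ h) x w ((g x).inverse (ν x)) :=
    ((D.smooth_h x hx).isSymmSndFDerivAt two_le_infty) _ _
  rw [D.metric.christoffel_symm hx, h5]
  linarith

theorem quadratic_identity (w : Euc k) :
    Φ x ((g x).inverse (b x ((g x).inverse (b x w)))) ((g x).inverse (fderiv ℝ h x))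
      = b x ((g x).inverse (ν x)) ((g x).inverse (ν x))
          * Φ x ((g x).inverse (b x w)) ((g x).inverse (fderiv ℝ h x))
        + (c + 3) / 4 * Φ x w ((g x).inverse (fderiv ℝ h x)) := by
  have hX := (((D.metric.contDiffAt_inverse hx).clm_apply
    (D.contDiffAt_fderiv_h hx)).differentiableAt (by simp)).hasFDerivAt
  have hd := ((D.contDiffAt_fderiv_h hx).differentiableAt (by simp)).hasFDerivAt
  have hb := ((D.smooth_b x hx).differentiableAt (by simp)).hasFDerivAt
  have h1 : HasFDerivAt (fun z => b z ((g z).inverse (fderiv ℝ h z)) w) _ x :=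
    (hb.clm_apply hX).clm_apply (hasFDerivAt_const w x)
  have h2 : HasFDerivAt (fun z => -(r * h z) * fderiv ℝ h z w) _ x :=
    (((D.hasFDerivAt_h hx).const_mul r).neg).mul (hd.clm_apply (hasFDerivAt_const w x))
  have e : (fun z => b z ((g z).inverse (fderiv ℝ h z)) w) =ᶠ[𝓝 x]
      fun z => -(r * h z) * fderiv ℝ h z w := by
    filter_upwards [D.metric.mem_nhds hx] with z hz using D.b_grad hz w
  have h3 := congrArg (fun L : Euc k →L[ℝ] ℝ => L ((g x).inverse (ν x))) e.fderiv_eq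
  simp only [h1.fderiv, h2.fderiv] at h3
  simp [D.fderiv_h_V hx] at h3
  have h4 := D.metric.inner_cov_sharp hx (D.contDiffAt_fderiv_h hx) ((g x).inverse (ν x))
    ((g x).inverse (b x w))
  rw [weingarten_inner D.metric hx, D.b_symm x hx, map_add, add_apply, D.hess_V hx] at h4
  have h5 := D.hess_V hx w
  have h6 := D.b_grad hx (christoffel g x ((g x).inverse (ν x)) w)
  have h7 := D.codazzi x hx ((g x).inverse (ν x)) w ((g x).inverse (fderiv ℝ h x))
  rw [D.covForm_symm hx, D.covForm_V hx, D.weingarten_grad hx, D.ν_V x hx, map_smul,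
    D.Φ_skew x hx ((g x).inverse (ν x)), D.Φ_skew x hx ((g x).inverse (ν x)), D.Φ_V x hx,
    D.Φ_V x hx, (D.metric.inner x hx).apply_inverse_comm (ν x), D.fderiv_h_V hx, covForm] at h7
  simp only [smul_eq_mul] at h7
  linear_combination h7 - h3 + h4 + h6 + r * h x * h5

theorem not_pseudoHopfData : False := by
  have hX : (g x).inverse (fderiv ℝ h x) ≠ 0 := by
    intro h0
    refine D.h_ne x hx ?_
    rw [← (D.metric.inner x hx).apply_inverse (fderiv ℝ h x), h0, map_zero]
  have hcp := D.c_pos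
  have key : ∀ z ∈ U, (-(r * h z)) * (-(r * h z))
      + r * h z * b z ((g z).inverse (ν z)) ((g z).inverse (ν z)) = (c + 3) / 4
      ∧ 2 * (r * h z) + b z ((g z).inverse (ν z)) ((g z).inverse (ν z)) ≠ 0 := by
    intro z hz
    have hζ : fderiv ℝ h z ((g z).inverse (η z)) = 0 := by
      have h1 := D.tangential_ζ hz
      rw [D.fderiv_h_V hz, mul_zero] at h1
      exact (mul_eq_zero.1 h1.symm).resolve_left (mul_pos D.α_pos (D.h_pos z hz)).ne'
    have hνX : ν z ((g z).inverse (fderiv ℝ h z)) = 0 := by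
      rw [(D.metric.inner z hz).apply_inverse_comm, D.fderiv_h_V hz]
    have hηX : η z ((g z).inverse (fderiv ℝ h z)) = 0 := by
      rw [(D.metric.inner z hz).apply_inverse_comm, hζ]
    have hXz : (g z).inverse (fderiv ℝ h z) ≠ 0 := by
      intro h0
      refine D.h_ne z hz ?_
      rw [← (D.metric.inner z hz).apply_inverse (fderiv ℝ h z), h0, map_zero]
    obtain ⟨u, hu⟩ : ∃ u, Φ z u ((g z).inverse (fderiv ℝ h z)) ≠ 0 := by
      by_contra! hall
      exact hXz (D.Φ_nondeg z hz _ hall hηX hνX)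
    have hlin : ∀ u, (-2 * (r * h z) - b z ((g z).inverse (ν z)) ((g z).inverse (ν z)))
        * Φ z ((g z).inverse (b z u)) ((g z).inverse (fderiv ℝ h z))
        = (-(r * h z) * b z ((g z).inverse (ν z)) ((g z).inverse (ν z)) + (c + 3) / 2)
          * Φ z u ((g z).inverse (fderiv ℝ h z)) := by
      intro u
      have h1 := D.hopf_identity hz u ((g z).inverse (fderiv ℝ h z))
      rw [D.fderiv_δ hz ((g z).inverse (fderiv ℝ h z)), hνX, D.weingarten_grad hz, map_smul,
        map_smul] at h1
      simp only [smul_eq_mul] at h1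
      linear_combination h1
    have h1 := hlin u
    have h2 := hlin ((g z).inverse (b z u))
    have h3 := D.quadratic_identity hz u
    set δ := b z ((g z).inverse (ν z)) ((g z).inverse (ν z))
    set l := r * h z
    set p := Φ z u ((g z).inverse (fderiv ℝ h z))
    set q := Φ z ((g z).inverse (b z u)) ((g z).inverse (fderiv ℝ h z))
    rw [h3] at h2
    constructor
    · have h4 : (δ ^ 2 + (c + 3)) * (l ^ 2 + l * δ - (c + 3) / 4) * p = 0 := by
        linear_combination (-2 * l - δ) * h2 + (-(l * δ) + (c + 3) / 2 + (2 * l + δ) * δ) * h1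
      have h5 : (δ ^ 2 + (c + 3)) * (l ^ 2 + l * δ - (c + 3) / 4) = 0 :=
        (mul_eq_zero.1 h4).resolve_right hu
      have h6 := (mul_eq_zero.1 h5).resolve_left (by positivity)
      linear_combination h6
    · intro h0
      have h4 : -2 * l - δ = 0 := by linarith
      rw [h4, zero_mul] at h1
      have h5 := (mul_eq_zero.1 h1.symm).resolve_right hu
      have h6 : δ = -2 * l := by linarith
      rw [h6] at h5
      nlinarith [sq_nonneg l]
  have hδ := ((D.contDiffAt_δ hx).differentiableAt (by simp)).hasFDerivAt
  have hδX := D.fderiv_δ hx ((g x).inverse (fderiv ℝ h x))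
  rw [(D.metric.inner x hx).apply_inverse_comm (ν x), D.fderiv_h_V hx, mul_zero] at hδX
  have hne := (key x hx).2
  have e : (fun z => (-(r * h z)) * (-(r * h z))
      + r * h z * b z ((g z).inverse (ν z)) ((g z).inverse (ν z)))
      =ᶠ[𝓝 x] fun _ => (c + 3) / 4 := by
    filter_upwards [D.metric.mem_nhds hx] with z hz using (key z hz).1
  set δ : Euc k → ℝ := fun z => b z ((g z).inverse (ν z)) ((g z).inverse (ν z)) with hδdef
  have hl := (D.hasFDerivAt_h hx).const_mul r
  have h1 : HasFDerivAt (fun z => (-(r * h z)) * (-(r * h z)) + r * h z * δ z) _ x :=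
    (hl.neg.mul hl.neg).add (hl.mul hδ)
  have e' : (fun z => (-(r * h z)) * (-(r * h z)) + r * h z * δ z)
      =ᶠ[𝓝 x] fun _ => (c + 3) / 4 := e
  have h3 := congrArg (fun L : Euc k →L[ℝ] ℝ => L ((g x).inverse (fderiv ℝ h x))) e'.fderiv_eq
  simp only [h1.fderiv] at h3
  simp [hδX] at h3
  have hpos : 0 < fderiv ℝ h x ((g x).inverse (fderiv ℝ h x)) := by
    have := (D.metric.inner x hx).pos _ hX
    rwa [(D.metric.inner x hx).apply_inverse] at this
  have h4 : (2 * (r * h x) + δ x) * (r * fderiv ℝ h x ((g x).inverse (fderiv ℝ h x))) = 0 := by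
    linear_combination h3
  exact (mul_pos D.r_pos hpos).ne' ((mul_eq_zero.1 h4).resolve_left hne)

end

end PseudoHopfData

end Intrinsic

/-! ### Sasakian space forms in coordinates -/

section Sasakian

variable {n : ℕ}

/-- The coordinate expression of a Sasakian space form on the open set `W`. -/
structure SasakianOn (W : Set (Euc n)) (G : FormField n) (φ : Euc n → Euc n →L[ℝ] Euc n)
    (ξ : Euc n → Euc n) (η : Euc n → Euc n →L[ℝ] ℝ) (c : ℝ) : Prop where
  metric : RiemannianOn W G
  smooth_φ : ∀ y ∈ W, ContDiffAt ℝ ∞ φ y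
  smooth_ξ : ∀ y ∈ W, ContDiffAt ℝ ∞ ξ y
  φ_φ : ∀ y ∈ W, ∀ u, φ y (φ y u) = -u + η y u • ξ y
  η_ξ : ∀ y ∈ W, η y (ξ y) = 1
  φ_ξ : ∀ y ∈ W, φ y (ξ y) = 0
  η_eq : ∀ y ∈ W, ∀ u, η y u = G y (ξ y) u
  G_φ_φ : ∀ y ∈ W, ∀ u v, G y (φ y u) (φ y v) = G y u v - η y u * η y v
  sasaki : ∀ y ∈ W, ∀ u v, fderiv ℝ φ y u v + christoffel G y u (φ y v)
    - φ y (christoffel G y u v) = G y u v • ξ y - η y v • u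
  curv : ∀ y ∈ W, ∀ u v w, curvature G y u v w =
    -((c - 1) / 4) • (η y w • (η y v • u - η y u • v)
        + (G y v w * η y u - G y u w * η y v) • ξ y
        + G y (φ y u) w • φ y v + (2 * G y (φ y u) v) • φ y w - G y (φ y v) w • φ y u)
      + ((c + 3) / 4) • (G y v w • u - G y u w • v)

namespace SasakianOn

variable {W : Set (Euc n)} {G : FormField n} {φ : Euc n → Euc n →L[ℝ] Euc n}
  {ξ : Euc n → Euc n} {η : Euc n → Euc n →L[ℝ] ℝ} {c : ℝ} (S : SasakianOn W G φ ξ η c)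
  {y : Euc n} (hy : y ∈ W)
include S hy

theorem η_φ (u : Euc n) : η y (φ y u) = 0 := by
  have h1 := S.φ_φ y hy (φ y u)
  rw [S.φ_φ y hy u, map_add, map_neg, map_smul, S.φ_ξ y hy, smul_zero, add_zero] at h1
  have h2 := congrArg (η y) h1
  rw [map_add, map_smul, S.η_ξ y hy, smul_eq_mul, mul_one] at h2
  linarith

theorem inner_ξ (u : Euc n) : G y u (ξ y) = η y u := by
  rw [S.η_eq y hy, (S.metric.inner y hy).symm]

theorem φ_skew (u v : Euc n) : G y (φ y u) v = -G y u (φ y v) := by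
  have h1 := S.G_φ_φ y hy u (φ y v)
  rw [S.φ_φ y hy, map_add, map_neg, map_smul, S.inner_ξ hy, S.η_φ hy, S.η_φ hy] at h1
  simp at h1
  linarith

theorem inner_φ_self (u : Euc n) : G y u (φ y u) = 0 := by
  have h1 := S.φ_skew hy u u
  rw [(S.metric.inner y hy).symm] at h1
  linarith

theorem contDiffAt_η : ContDiffAt ℝ ∞ η y := by
  have e : η =ᶠ[𝓝 y] fun z => G z (ξ z) := by
    filter_upwards [S.metric.mem_nhds hy] with z hz
    ext u
    exact S.η_eq z hz u
  exact ((S.metric.smooth y hy).clm_apply (S.smooth_ξ y hy)).congr_of_eventuallyEq e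

theorem hasFDerivAt_φ : HasFDerivAt φ (fderiv ℝ φ y) y :=
  ((S.smooth_φ y hy).differentiableAt (by simp)).hasFDerivAt

theorem hasFDerivAt_ξ : HasFDerivAt ξ (fderiv ℝ ξ y) y :=
  ((S.smooth_ξ y hy).differentiableAt (by simp)).hasFDerivAt

theorem hasFDerivAt_η : HasFDerivAt η (fderiv ℝ η y) y :=
  ((S.contDiffAt_η hy).differentiableAt (by simp)).hasFDerivAt

/-- `∇_u ξ = -φu`. -/
theorem cov_ξ (u : Euc n) : fderiv ℝ ξ y u + christoffel G y u (ξ y) = -φ y u := by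
  have hG := S.metric.inner y hy
  set T := fderiv ℝ ξ y u + christoffel G y u (ξ y) with hT
  have h1 : HasFDerivAt (fun z => φ z (ξ z)) _ y := (S.hasFDerivAt_φ hy).clm_apply (S.hasFDerivAt_ξ hy)
  have e1 : (fun z => φ z (ξ z)) =ᶠ[𝓝 y] fun _ => 0 := by
    filter_upwards [S.metric.mem_nhds hy] with z hz using S.φ_ξ z hz
  have h2 := congrArg (fun L : Euc n →L[ℝ] Euc n => L u) e1.fderiv_eq
  simp only [h1.fderiv] at h2
  simp at h2
  have h3 := S.sasaki y hy u (ξ y)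
  rw [S.φ_ξ y hy, map_zero, S.η_ξ y hy, one_smul, S.inner_ξ hy] at h3
  have hφT : φ y T = u - η y u • ξ y := by
    rw [hT, map_add]
    have : fderiv ℝ φ y u (ξ y) = -φ y (fderiv ℝ ξ y u) := eq_neg_of_add_eq_zero_right h2
    rw [this] at h3
    rw [← neg_inj, neg_sub, ← h3]
    abel
  have h4 : HasFDerivAt (fun z => G z (ξ z) (ξ z)) _ y :=
    ((S.metric.differentiableAt hy).hasFDerivAt.clm_apply (S.hasFDerivAt_ξ hy)).clm_apply
      (S.hasFDerivAt_ξ hy)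
  have e2 : (fun z => G z (ξ z) (ξ z)) =ᶠ[𝓝 y] fun _ => 1 := by
    filter_upwards [S.metric.mem_nhds hy] with z hz
    rw [← S.η_eq z hz, S.η_ξ z hz]
  have h5 := congrArg (fun L : Euc n →L[ℝ] ℝ => L u) e2.fderiv_eq
  simp only [h4.fderiv] at h5
  simp at h5
  rw [S.metric.fderiv_eq hy, S.inner_ξ hy, S.inner_ξ hy, ← S.η_eq y hy, ← S.η_eq y hy] at h5
  have hηT : η y T = 0 := by
    rw [hT, map_add]
    linarith
  have h6 := S.φ_φ y hy T
  rw [hφT, hηT, zero_smul, add_zero, map_sub, map_smul, S.φ_ξ y hy, smul_zero, sub_zero] at h6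
  rw [h6, neg_neg]

theorem fderiv_η (u v : Euc n) :
    fderiv ℝ η y u v = η y (christoffel G y u v) + G y u (φ y v) := by
  have h1 : HasFDerivAt (fun z => G z (ξ z) v) _ y :=
    ((S.metric.differentiableAt hy).hasFDerivAt.clm_apply (S.hasFDerivAt_ξ hy)).clm_apply
      (hasFDerivAt_const v y)
  have h2 : HasFDerivAt (fun z => η z v) _ y :=
    (S.hasFDerivAt_η hy).clm_apply (hasFDerivAt_const v y)
  have e : (fun z => η z v) =ᶠ[𝓝 y] fun z => G z (ξ z) v := by
    filter_upwards [S.metric.mem_nhds hy] with z hz using S.η_eq z hz v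
  have h3 := congrArg (fun L : Euc n →L[ℝ] ℝ => L u) e.fderiv_eq
  simp only [h1.fderiv, h2.fderiv] at h3
  simp at h3
  rw [S.metric.fderiv_eq hy, ← S.η_eq y hy] at h3
  have h4 := congrArg (fun t => G y t v) (S.cov_ξ hy u)
  simp only [map_add, add_apply, map_neg, neg_apply] at h4
  rw [S.φ_skew hy] at h4
  linarith

theorem fderiv_φ (u v : Euc n) : fderiv ℝ φ y u v
    = G y u v • ξ y - η y v • u - christoffel G y u (φ y v) + φ y (christoffel G y u v) := by
  rw [← S.sasaki y hy]
  abel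

theorem ricci_eq (v w : Euc n) :
    ricci G y v w = ((c - 1) / 2 + (n - 1) * (c + 3) / 4) * G y v w
      - (c - 1) * (n + 1) / 4 * (η y v * η y w) := by
  have htr : ∀ (a : Euc n →L[ℝ] ℝ) (z : Euc n), ∑ i, a (EuclideanSpace.single i 1) * z i = a z := by
    intro a z
    rw [clm_eq_sum a z]
    simp [mul_comm]
  have h1 : ∑ i : Fin n, (EuclideanSpace.single i (1 : ℝ) : Euc n) i = n := by simp
  have h2 := sum_apply_eq_zero_of_skew (S.metric.inner y hy) (φ y) (S.φ_skew hy)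
  have h3 := htr (η y) v
  have h4 := htr (η y) (ξ y)
  have h5 := htr ((G y).flip w) (ξ y)
  have h6 := htr ((G y).flip w) v
  have h7 := htr ((G y).flip w ∘L φ y) (φ y v)
  have h8 := htr ((G y).flip v ∘L φ y) (φ y w)
  simp only [ContinuousLinearMap.flip_apply, ContinuousLinearMap.comp_apply] at h5 h6 h7 h8
  have hpt : ∀ i : Fin n, curvature G y (EuclideanSpace.single i 1) v w i
      = -((c - 1) / 4) * (η y w * η y v * (EuclideanSpace.single i (1 : ℝ) : Euc n) i
          - η y w * (η y (EuclideanSpace.single i 1) * v i)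
          + G y v w * (η y (EuclideanSpace.single i 1) * ξ y i)
          - η y v * (G y (EuclideanSpace.single i 1) w * ξ y i)
          + G y (φ y (EuclideanSpace.single i 1)) w * φ y v i
          + 2 * (G y (φ y (EuclideanSpace.single i 1)) v * φ y w i)
          - G y (φ y v) w * φ y (EuclideanSpace.single i 1) i)
        + (c + 3) / 4 * (G y v w * (EuclideanSpace.single i (1 : ℝ) : Euc n) i
          - G y (EuclideanSpace.single i 1) w * v i) := by
    intro i
    rw [S.curv y hy]
    simp only [PiLp.add_apply, PiLp.sub_apply, PiLp.smul_apply, smul_eq_mul]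
    ring
  rw [ricci, Finset.sum_congr rfl fun i _ => hpt i]
  simp only [Finset.sum_add_distrib, Finset.sum_sub_distrib, ← Finset.mul_sum]
  rw [h1, h2, h3, h4, h5, h6, h7, h8, S.η_ξ y hy, ← S.η_eq y hy w, S.φ_φ y hy, S.φ_φ y hy]
  simp only [map_add, add_apply, map_neg, neg_apply, map_smul, smul_apply, smul_eq_mul]
  rw [← S.η_eq y hy w, ← S.η_eq y hy v, (S.metric.inner y hy).symm w v]
  ring

/-- The Ricci tensor of a Sasakian space form is `αg + βη ⊗ η`. -/
theorem ricciForm_eq : ricciForm G y = ((c - 1) / 2 + (n - 1) * (c + 3) / 4 : ℝ) • G y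
    + (-((c - 1) * (n + 1) / 4) : ℝ) • (η y).smulRight (η y) := by
  set B := ((c - 1) / 2 + (n - 1) * (c + 3) / 4 : ℝ) • G y
    + (-((c - 1) * (n + 1) / 4) : ℝ) • (η y).smulRight (η y) with hB
  have hr : ∀ v w, ricci G y v w = B v w := by
    intro v w
    rw [S.ricci_eq hy, hB]
    simp
    ring
  ext v w
  have e : B v w = ∑ i, ∑ j, v i * (w j * B (EuclideanSpace.single i 1)
      (EuclideanSpace.single j 1)) := by
    rw [clm_eq_sum B v]
    simp only [sum_apply, smul_apply]
    refine Finset.sum_congr rfl fun i _ => ?_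
    rw [clm_eq_sum (B (EuclideanSpace.single i 1)) w]
    simp [Finset.mul_sum]
  rw [e]
  simp only [ricciForm, hr, sum_apply]
  refine Finset.sum_congr rfl fun i _ => Finset.sum_congr rfl fun j _ => ?_
  simp
  ring

end SasakianOn

end Sasakian

/-! ### The Ricci metric -/

section RicciMetric

variable {n : ℕ} {W : Set (Euc n)} {G : FormField n} {φ : Euc n → Euc n →L[ℝ] Euc n}
  {ξ : Euc n → Euc n} {η : Euc n → Euc n →L[ℝ] ℝ} {c α β : ℝ}

/-- `K` is the Riemannian metric `αG + βη ⊗ η`. -/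
structure DeformationOn (W : Set (Euc n)) (G K : FormField n) (η : Euc n → Euc n →L[ℝ] ℝ)
    (α β : ℝ) : Prop where
  metric : RiemannianOn W K
  eq : ∀ y ∈ W, K y = α • G y + β • (η y).smulRight (η y)
  α_pos : 0 < α

namespace DeformationOn

variable {K : FormField n} (R : DeformationOn W G K η α β) (S : SasakianOn W G φ ξ η c)
  {y : Euc n} (hy : y ∈ W)
include R hy

theorem apply (u v : Euc n) : K y u v = α * G y u v + β * (η y u * η y v) := by
  rw [R.eq y hy]
  simp

include S

theorem christoffel_eq (u v : Euc n) : christoffel K y u v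
    = christoffel G y u v + (-(β / α)) • (η y u • φ y v + η y v • φ y u) := by
  have hα := R.α_pos.ne'
  refine R.metric.christoffel_eq_of_compatible hy
    (L := fun u v => christoffel G y u v + (-(β / α)) • (η y u • φ y v + η y v • φ y u))
    (fun u v => ?_) (fun u v w => ?_) u v
  · rw [S.metric.christoffel_symm hy, add_comm (η y u • φ y v)]
  · have e : (fun z => K z v w) =ᶠ[𝓝 y] fun z => α * G z v w + β * (η z v * η z w) := by
      filter_upwards [S.metric.mem_nhds hy] with z hz using R.apply hz v w
    have hη := fun v : Euc n => (S.hasFDerivAt_η hy).clm_apply (hasFDerivAt_const v y)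
    have h1 : HasFDerivAt (fun z => α * G z v w + β * (η z v * η z w)) _ y :=
      (((((S.metric.differentiableAt hy).hasFDerivAt).clm_apply
        (hasFDerivAt_const v y)).clm_apply (hasFDerivAt_const w y)).const_mul α).add
        (((hη v).mul (hη w)).const_mul β)
    rw [← fderiv_apply_apply (R.metric.differentiableAt hy), e.fderiv_eq, h1.fderiv]
    simp only [R.apply hy, map_add, map_smul, add_apply, smul_apply, smul_eq_mul, S.η_φ hy]
    simp
    rw [S.metric.fderiv_eq hy, S.fderiv_η hy, S.fderiv_η hy, S.φ_skew hy v w, S.φ_skew hy u w,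
      (S.metric.inner y hy).symm v (φ y u), S.φ_skew hy u v]
    field_simp
    ring

theorem curvature_eq (u v w : Euc n) : curvature K y u v w = curvature G y u v w
    + (-(β / α)) • ((2 * G y u (φ y v)) • φ y w + G y u (φ y w) • φ y v - G y v (φ y w) • φ y u
      + (η y v * G y u w - η y u * G y v w) • ξ y - (2 * η y w * η y v) • u
      + (2 * η y w * η y u) • v)
    + (β / α) ^ 2 • ((η y w * η y u) • φ y (φ y v) - (η y w * η y v) • φ y (φ y u)) := by
  have hd : ∀ u v w, fderiv ℝ (christoffel K) y u v w = fderiv ℝ (christoffel G) y u v w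
      + (-(β / α)) • (η y v • fderiv ℝ φ y u w + fderiv ℝ η y u v • φ y w
        + (η y w • fderiv ℝ φ y u v + fderiv ℝ η y u w • φ y v)) := by
    intro u v w
    have hΓK := ((R.metric.contDiffAt_christoffel hy).differentiableAt (by simp)).hasFDerivAt
    have hΓG := ((S.metric.contDiffAt_christoffel hy).differentiableAt (by simp)).hasFDerivAt
    have hη := fun v : Euc n => (S.hasFDerivAt_η hy).clm_apply (hasFDerivAt_const v y)
    have hφ := fun v : Euc n => (S.hasFDerivAt_φ hy).clm_apply (hasFDerivAt_const v y)
    have h1 : HasFDerivAt (fun z => christoffel K z v w) _ y :=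
      (hΓK.clm_apply (hasFDerivAt_const v y)).clm_apply (hasFDerivAt_const w y)
    have h2 : HasFDerivAt (fun z => christoffel G z v w
        + (-(β / α)) • (η z v • φ z w + η z w • φ z v)) _ y :=
      ((hΓG.clm_apply (hasFDerivAt_const v y)).clm_apply (hasFDerivAt_const w y)).add
        ((((hη v).smul (hφ w)).add ((hη w).smul (hφ v))).const_smul (-(β / α)))
    have e : (fun z => christoffel K z v w) =ᶠ[𝓝 y] fun z => christoffel G z v w
        + (-(β / α)) • (η z v • φ z w + η z w • φ z v) := by
      filter_upwards [S.metric.mem_nhds hy] with z hz using R.christoffel_eq S hz v w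
    have h3 := congrArg (fun L : Euc n →L[ℝ] Euc n => L u) e.fderiv_eq
    simp only [h1.fderiv, h2.fderiv] at h3
    simpa using h3
  have hs : G y v (φ y u) = -G y u (φ y v) := by
    rw [(S.metric.inner y hy).symm, S.φ_skew hy]
  rw [curvature, curvature, hd, hd]
  simp only [R.christoffel_eq S hy, S.fderiv_φ hy, S.fderiv_η hy, map_add, map_smul, S.η_φ hy, hs,
    S.metric.christoffel_symm hy v u, (S.metric.inner y hy).symm v u, smul_eq_mul]
  module

end DeformationOn

end RicciMetric

/-! ### Hypersurfaces tangent to the Reeb field -/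

section Reeb

variable {k : ℕ}

/-- A hypersurface of a Sasakian space form with unit normal `N`, tangent to `ξ`. -/
structure ReebHypersurface (U : Set (Euc k)) (W : Set (Euc (k + 1))) (G : FormField (k + 1))
    (φ : Euc (k + 1) → Euc (k + 1) →L[ℝ] Euc (k + 1)) (ξ : Euc (k + 1) → Euc (k + 1))
    (η : Euc (k + 1) → Euc (k + 1) →L[ℝ] ℝ) (c : ℝ) (f N : Euc k → Euc (k + 1)) : Prop where
  sasakian : SasakianOn W G φ ξ η c
  immersion : ImmersionOn U W f
  normal : NormalOn U G f N 1
  tangent : ∀ x ∈ U, ∃ u, fderiv ℝ f x u = ξ (f x)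

/-- The form `Φ(u, v) = g(φu, v)` induced on a hypersurface. -/
noncomputable def inducedΦ (G : FormField (k + 1))
    (φ : Euc (k + 1) → Euc (k + 1) →L[ℝ] Euc (k + 1)) (f : Euc k → Euc (k + 1)) : FormField k :=
  fun x => (G (f x) ∘L φ (f x)).bilinearComp (fderiv ℝ f x) (fderiv ℝ f x)

/-- The form induced by `η` on a hypersurface. -/
noncomputable def inducedη (η : Euc (k + 1) → Euc (k + 1) →L[ℝ] ℝ) (f : Euc k → Euc (k + 1))
    (x : Euc k) : Euc k →L[ℝ] ℝ := η (f x) ∘L fderiv ℝ f x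

/-- The form `ν(u) = g(V, u) = g(N, φu)` of a hypersurface with unit normal `N`. -/
noncomputable def inducedν (G : FormField (k + 1))
    (φ : Euc (k + 1) → Euc (k + 1) →L[ℝ] Euc (k + 1)) (f N : Euc k → Euc (k + 1))
    (x : Euc k) : Euc k →L[ℝ] ℝ := G (f x) (N x) ∘L φ (f x) ∘L fderiv ℝ f x

variable {U : Set (Euc k)} {W : Set (Euc (k + 1))} {G : FormField (k + 1)}
  {φ : Euc (k + 1) → Euc (k + 1) →L[ℝ] Euc (k + 1)} {ξ : Euc (k + 1) → Euc (k + 1)}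
  {η : Euc (k + 1) → Euc (k + 1) →L[ℝ] ℝ} {c : ℝ} {f N : Euc k → Euc (k + 1)}

theorem inducedΦ_apply (x u v : Euc k) : inducedΦ G φ f x u v
    = G (f x) (φ (f x) (fderiv ℝ f x u)) (fderiv ℝ f x v) := rfl

theorem inducedη_apply (x u : Euc k) : inducedη η f x u = η (f x) (fderiv ℝ f x u) := rfl

theorem inducedν_apply (x u : Euc k) : inducedν G φ f N x u
    = G (f x) (N x) (φ (f x) (fderiv ℝ f x u)) := rfl

namespace ReebHypersurface

variable (X : ReebHypersurface U W G φ ξ η c f N)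

include X in
theorem induced_metric : RiemannianOn U (induced G f) :=
  X.immersion.riemannianOn_induced X.sasakian.metric

variable {x : Euc k} (hx : x ∈ U)
include X hx

theorem mem : f x ∈ W := X.immersion.mapsTo x hx

theorem inner_symm (u v : Euc (k + 1)) : G (f x) u v = G (f x) v u :=
  (X.sasakian.metric.inner _ (X.mem hx)).symm u v

theorem η_N : η (f x) (N x) = 0 := by
  obtain ⟨u, hu⟩ := X.tangent x hx
  rw [← X.sasakian.inner_ξ (X.mem hx), ← hu, X.normal.normal x hx]

theorem inner_N_ξ : G (f x) (N x) (ξ (f x)) = 0 := by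
  rw [X.sasakian.inner_ξ (X.mem hx), X.η_N hx]

theorem fderiv_ζ : fderiv ℝ f x ((induced G f x).inverse (inducedη η f x)) = ξ (f x) := by
  obtain ⟨u, hu⟩ := X.tangent x hx
  have : inducedη η f x = induced G f x u := by
    ext w
    rw [inducedη_apply, induced_apply, hu, X.sasakian.η_eq _ (X.mem hx)]
  rw [this, (X.induced_metric.inner x hx).inverse_apply, hu]

theorem fderiv_V :
    fderiv ℝ f x ((induced G f x).inverse (inducedν G φ f N x)) = -φ (f x) (N x) := by
  obtain ⟨u, hu⟩ := X.normal.exists_tangent X.immersion hx (y := -φ (f x) (N x))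
    (by rw [map_neg, X.sasakian.inner_φ_self (X.mem hx), neg_zero])
  have : inducedν G φ f N x = induced G f x u := by
    ext w
    rw [inducedν_apply, induced_apply, hu, map_neg, neg_apply, X.sasakian.φ_skew (X.mem hx),
      neg_neg]
  rw [this, (X.induced_metric.inner x hx).inverse_apply, hu]

theorem fderiv_weingarten (u : Euc k) :
    fderiv ℝ f x ((induced G f x).inverse (scalarForm G f N x u)) = -covAlong G f N x u := by
  have hself := X.normal.inner_covAlong_self X.immersion X.sasakian.metric hx u
  rw [X.inner_symm hx] at hself
  obtain ⟨v, hv⟩ := X.normal.exists_tangent X.immersion hx (y := -covAlong G f N x u)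
    (by rw [map_neg, hself, neg_zero])
  have : scalarForm G f N x u = induced G f x v := by
    ext w
    rw [induced_apply, hv, map_neg, neg_apply,
      X.normal.inner_covAlong_tangent X.immersion X.sasakian.metric hx, neg_neg]
  rw [this, (X.induced_metric.inner x hx).inverse_apply, hv]

theorem contDiffAt_inducedη : ContDiffAt ℝ ∞ (inducedη η f) x :=
  ((X.sasakian.contDiffAt_η (X.mem hx)).comp x (X.immersion.smooth x hx)).clm_comp
    (X.immersion.contDiffAt_fderiv hx)

theorem contDiffAt_inducedν : ContDiffAt ℝ ∞ (inducedν G φ f N) x :=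
  ((X.immersion.contDiffAt_metric hx X.sasakian.metric).clm_apply
    (X.normal.smooth x hx)).clm_comp
    (((X.sasakian.smooth_φ _ (X.mem hx)).comp x (X.immersion.smooth x hx)).clm_comp
      (X.immersion.contDiffAt_fderiv hx))

theorem inducedη_V : inducedη η f x ((induced G f x).inverse (inducedν G φ f N x)) = 0 := by
  rw [inducedη_apply, X.fderiv_V hx, map_neg, X.sasakian.η_φ (X.mem hx), neg_zero]

theorem inducedν_V : inducedν G φ f N x ((induced G f x).inverse (inducedν G φ f N x)) = 1 := by
  rw [inducedν_apply, X.fderiv_V hx, map_neg, X.sasakian.φ_φ _ (X.mem hx), X.η_N hx, zero_smul,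
    add_zero, neg_neg, X.normal.norm x hx]

theorem inducedη_ζ : inducedη η f x ((induced G f x).inverse (inducedη η f x)) = 1 := by
  rw [inducedη_apply, X.fderiv_ζ hx, X.sasakian.η_ξ _ (X.mem hx)]

theorem inducedν_ζ : inducedν G φ f N x ((induced G f x).inverse (inducedη η f x)) = 0 := by
  rw [inducedν_apply, X.fderiv_ζ hx, X.sasakian.φ_ξ _ (X.mem hx), map_zero]

theorem inner_φ_V (u : Euc k) : G (f x) (fderiv ℝ f x u)
    (φ (f x) (fderiv ℝ f x ((induced G f x).inverse (inducedν G φ f N x)))) = 0 := by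
  rw [X.fderiv_V hx, map_neg, X.sasakian.φ_φ _ (X.mem hx), X.η_N hx, zero_smul,
    add_zero, neg_neg, X.inner_symm hx, X.normal.normal x hx]

theorem inducedΦ_V (u : Euc k) :
    inducedΦ G φ f x u ((induced G f x).inverse (inducedν G φ f N x)) = 0 := by
  rw [inducedΦ_apply, X.sasakian.φ_skew (X.mem hx), X.inner_φ_V hx, neg_zero]

theorem inducedΦ_ζ (u : Euc k) :
    inducedΦ G φ f x u ((induced G f x).inverse (inducedη η f x)) = 0 := by
  rw [inducedΦ_apply, X.fderiv_ζ hx, X.sasakian.inner_ξ (X.mem hx), X.sasakian.η_φ (X.mem hx)]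

theorem inducedΦ_skew (u v : Euc k) : inducedΦ G φ f x u v = -inducedΦ G φ f x v u := by
  rw [inducedΦ_apply, inducedΦ_apply, X.sasakian.φ_skew (X.mem hx), X.inner_symm hx]

theorem inducedΦ_nondeg (w : Euc k) (h1 : ∀ u, inducedΦ G φ f x u w = 0)
    (h2 : inducedη η f x w = 0) (h3 : inducedν G φ f N x w = 0) : w = 0 := by
  have e : φ (f x) (fderiv ℝ f x w) = 0 := by
    rw [X.normal.eq_smul_of_normal X.immersion X.sasakian.metric hx
      (y := φ (f x) (fderiv ℝ f x w)) fun u => ?_, ← inducedν_apply, h3, zero_div, zero_smul]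
    have := h1 u
    rw [X.inducedΦ_skew hx, neg_eq_zero] at this
    exact this
  have h4 := X.sasakian.φ_φ _ (X.mem hx) (fderiv ℝ f x w)
  rw [e, map_zero, ← inducedη_apply, h2, zero_smul, add_zero, eq_comm, neg_eq_zero] at h4
  exact X.immersion.injective x hx (by rw [h4, map_zero])

theorem secondForm_eq (u v : Euc k) : secondForm G f x u v = scalarForm G f N x u v • N x := by
  rw [X.normal.secondForm_eq X.immersion X.sasakian.metric hx, div_one]

theorem cov_inducedη (u w : Euc k) :
    fderiv ℝ (inducedη η f) x u w - inducedη η f x (christoffel (induced G f) x u w)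
      = -inducedΦ G φ f x u w := by
  have h1 : HasFDerivAt (inducedη η f) _ x :=
    ((X.sasakian.hasFDerivAt_η (X.mem hx)).comp x (X.immersion.hasFDerivAt hx)).clm_comp
      (X.immersion.hasFDerivAt_fderiv hx)
  rw [h1.fderiv]
  have h2 := congrArg (η (f x)) (X.immersion.covAlong_fderiv (G := G) hx u w)
  rw [covAlong, X.immersion.fderiv_fderiv_apply hx, X.secondForm_eq hx, map_add, map_add, map_smul,
    X.η_N hx, smul_zero, add_zero] at h2
  simp only [inducedη_apply, inducedΦ_apply, X.sasakian.φ_skew (X.mem hx)]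
  simp [X.sasakian.fderiv_η (X.mem hx)]
  linarith

theorem cov_inducedν (u w : Euc k) :
    fderiv ℝ (inducedν G φ f N) x u w - inducedν G φ f N x (christoffel (induced G f) x u w)
      = inducedΦ G φ f x ((induced G f x).inverse (scalarForm G f N x u)) w := by
  have hτ : HasFDerivAt (fun z => φ (f z) (fderiv ℝ f z w)) _ x :=
    ((X.sasakian.hasFDerivAt_φ (X.mem hx)).comp x (X.immersion.hasFDerivAt hx)).clm_apply
      ((X.immersion.hasFDerivAt_fderiv hx).clm_apply (hasFDerivAt_const w x))
  have hν := ((X.contDiffAt_inducedν hx).differentiableAt (by simp)).hasFDerivAt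
  have h1 : fderiv ℝ (fun z => G (f z) (N z) (φ (f z) (fderiv ℝ f z w))) x u
      = fderiv ℝ (inducedν G φ f N) x u w := by
    have h0 : HasFDerivAt (fun z => inducedν G φ f N z w) _ x :=
      hν.clm_apply (hasFDerivAt_const w x)
    change fderiv ℝ (fun z => inducedν G φ f N z w) x u = _
    rw [h0.fderiv]
    simp
  rw [← h1, X.immersion.fderiv_inner hx X.sasakian.metric (X.normal.differentiableAt hx)
    hτ.differentiableAt, inducedΦ_apply, X.fderiv_weingarten hx, map_neg, map_neg, neg_apply,
    X.sasakian.φ_skew (X.mem hx), neg_neg]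
  have h2 : covAlong G f (fun z => φ (f z) (fderiv ℝ f z w)) x u
      = G (f x) (fderiv ℝ f x u) (fderiv ℝ f x w) • ξ (f x)
        - inducedη η f x w • fderiv ℝ f x u
        + φ (f x) (covAlong G f (fun z => fderiv ℝ f z w) x u) := by
    rw [covAlong, hτ.fderiv, covAlong, X.immersion.fderiv_fderiv_apply hx, inducedη_apply]
    simp [X.sasakian.fderiv_φ (X.mem hx)]
    abel
  rw [h2, X.immersion.covAlong_fderiv hx, X.secondForm_eq hx]
  simp only [map_add, map_sub, map_smul, X.inner_N_ξ hx, X.normal.normal x hx,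
    X.sasakian.inner_φ_self (X.mem hx), inducedν_apply]
  simp

theorem scalarForm_comm (u v : Euc k) : scalarForm G f N x u v = scalarForm G f N x v u :=
  NormalOn.scalarForm_symm X.immersion X.sasakian.metric hx u v

/-- `Aξ = -V`. -/
theorem scalarForm_ζ (w : Euc k) :
    scalarForm G f N x ((induced G f x).inverse (inducedη η f x)) w = -inducedν G φ f N x w := by
  have hξ : HasFDerivAt (fun z => ξ (f z)) _ x :=
    (X.sasakian.hasFDerivAt_ξ (X.mem hx)).comp x (X.immersion.hasFDerivAt hx)
  have h1 := X.immersion.fderiv_inner hx X.sasakian.metric (X.normal.differentiableAt hx)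
    hξ.differentiableAt w
  have e : (fun z => G (f z) (N z) (ξ (f z))) =ᶠ[𝓝 x] fun _ => 0 := by
    filter_upwards [X.immersion.mem_nhds hx] with z hz using X.inner_N_ξ hz
  have h2 : covAlong G f (fun z => ξ (f z)) x w = -φ (f x) (fderiv ℝ f x w) := by
    rw [← X.sasakian.cov_ξ (X.mem hx), covAlong, hξ.fderiv]
    simp
  have h3 := X.normal.inner_covAlong_tangent X.immersion X.sasakian.metric hx w
    ((induced G f x).inverse (inducedη η f x))
  rw [X.fderiv_ζ hx] at h3
  rw [e.fderiv_eq, h2, h3, map_neg, ← inducedν_apply] at h1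
  simp at h1
  rw [X.scalarForm_comm hx]
  linarith

theorem codazzi (u v w : Euc k) :
    covForm (induced G f) (scalarForm G f N) x u v w
        - covForm (induced G f) (scalarForm G f N) x v u w
      = -((c - 1) / 4) * (inducedΦ G φ f x u w * inducedν G φ f N x v
        + 2 * inducedΦ G φ f x u v * inducedν G φ f N x w
        - inducedΦ G φ f x v w * inducedν G φ f N x u) := by
  rw [X.normal.codazzi X.immersion X.sasakian.metric hx, X.sasakian.curv _ (X.mem hx)]
  simp only [map_add, map_sub, map_smul, X.inner_N_ξ hx, X.normal.normal x hx, smul_eq_mul,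
    inducedν_apply, inducedΦ_apply]
  ring

/-! ### The tangential Ricci-biharmonic equation -/

section Deformation

variable {K : FormField (k + 1)} {α β : ℝ} (R : DeformationOn W G K η α β)
include R

omit hx in
theorem normal_deformation : NormalOn U K f N α where
  smooth := X.normal.smooth
  normal x hx u := by
    rw [R.apply (X.mem hx), X.normal.normal x hx, X.η_N hx]
    ring
  norm x hx := by
    rw [R.apply (X.mem hx), X.normal.norm x hx, X.η_N hx]
    ring
  pos := R.α_pos

theorem deformation_N (v : Euc (k + 1)) : K (f x) (N x) v = α * G (f x) (N x) v := by
  rw [R.apply (X.mem hx), X.η_N hx]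
  ring

theorem scalarForm_deformation (u v : Euc k) : scalarForm K f N x u v
    = α * scalarForm G f N x u v
      - β * (inducedη η f x u * inducedν G φ f N x v
        + inducedη η f x v * inducedν G φ f N x u) := by
  have hα := R.α_pos.ne'
  rw [← (X.normal_deformation R).inner_covAlong_fderiv X.immersion hx,
    ← X.normal.inner_covAlong_fderiv X.immersion hx, X.deformation_N hx R, covAlong, covAlong,
    R.christoffel_eq X.sasakian (X.mem hx)]
  simp only [map_add, map_smul, smul_eq_mul, inducedη_apply, inducedν_apply]
  field_simp
  ring

theorem induced_deformation (u v : Euc k) : induced K f x u v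
    = α * induced G f x u v + β * (inducedη η f x u * inducedη η f x v) := by
  rw [induced_apply, R.apply (X.mem hx)]
  rfl

theorem inverse_deformation (hαβ : α + β ≠ 0) (a : Euc k →L[ℝ] ℝ) :
    (induced K f x).inverse a = (1 / α) • (induced G f x).inverse a
      - (β / (α * (α + β)) * a ((induced G f x).inverse (inducedη η f x))) •
        (induced G f x).inverse (inducedη η f x) := by
  have hα := R.α_pos.ne'
  have hK := (X.immersion.riemannianOn_induced R.metric).inner x hx
  have hg := X.induced_metric.inner x hx
  refine hK.ext fun w => ?_
  rw [hK.apply_inverse, X.induced_deformation hx R]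
  simp only [map_sub, map_smul, sub_apply, smul_apply, smul_eq_mul, hg.apply_inverse,
    X.inducedη_ζ hx, hg.apply_inverse_comm (inducedη η f x) a]
  field_simp
  ring

theorem formTrace_deformation (hαβ : α + β ≠ 0) (T : Euc k →L[ℝ] Euc k →L[ℝ] ℝ) :
    formTrace (induced K f x) (fun u v => T u v)
      = 1 / α * formTrace (induced G f x) (fun u v => T u v)
        - β / (α * (α + β)) * T ((induced G f x).inverse (inducedη η f x))
          ((induced G f x).inverse (inducedη η f x)) := by
  simp only [formTrace, X.inverse_deformation hx R hαβ, map_sub, map_smul, smul_eq_mul]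
  rw [Finset.sum_sub_distrib, ← Finset.mul_sum]
  congr 1
  conv_rhs => rw [clm_eq_sum T ((induced G f x).inverse (inducedη η f x))]
  simp only [sum_apply, smul_apply, smul_eq_mul, Finset.mul_sum]
  refine Finset.sum_congr rfl fun i _ => ?_
  simp
  ring

theorem inverse_deformation_ν (hαβ : α + β ≠ 0) :
    (induced K f x).inverse (inducedν G φ f N x)
      = (1 / α) • (induced G f x).inverse (inducedν G φ f N x) := by
  rw [X.inverse_deformation hx R hαβ, X.inducedν_ζ hx]
  simp

/-- The trace of the second fundamental form with respect to the deformed metric. -/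
theorem formTrace_scalarForm_deformation (hαβ : α + β ≠ 0) :
    formTrace (induced K f x) (fun u v => scalarForm K f N x u v)
      = formTrace (induced G f x) fun u v => scalarForm G f N x u v := by
  have hα := R.α_pos.ne'
  have hg := X.induced_metric.inner x hx
  have h1 : formTrace (induced G f x) (fun u v => scalarForm K f N x u v)
      = α * formTrace (induced G f x) (fun u v => scalarForm G f N x u v) := by
    have e : (fun u v => scalarForm K f N x u v) = fun u v => α * scalarForm G f N x u v
        - β * (inducedη η f x u * inducedν G φ f N x v
          + inducedν G φ f N x u * inducedη η f x v) := by
      ext u v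
      rw [X.scalarForm_deformation hx R]
      ring
    rw [e, formTrace_sub, formTrace_mul, formTrace_mul, formTrace_add, formTrace_mul_apply,
      formTrace_mul_apply, X.inducedν_ζ hx, X.inducedη_V hx]
    ring
  rw [X.formTrace_deformation hx R hαβ, h1, X.scalarForm_deformation hx R, X.scalarForm_ζ hx,
    X.inducedν_ζ hx]
  field_simp
  ring

theorem inner_N_curvature (u v w : Euc k) :
    G (f x) (N x) (curvature K (f x) (fderiv ℝ f x u) (fderiv ℝ f x v) (fderiv ℝ f x w))
      = (-(β / α) + (c - 1) / 4) *
        (2 * G (f x) (fderiv ℝ f x u) (φ (f x) (fderiv ℝ f x v)) * inducedν G φ f N x w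
          + G (f x) (fderiv ℝ f x u) (φ (f x) (fderiv ℝ f x w)) * inducedν G φ f N x v
          - G (f x) (fderiv ℝ f x v) (φ (f x) (fderiv ℝ f x w)) * inducedν G φ f N x u) := by
  rw [R.curvature_eq X.sasakian (X.mem hx), X.sasakian.curv _ (X.mem hx)]
  simp only [map_add, map_sub, map_smul, map_neg, X.inner_N_ξ hx, X.normal.normal x hx,
    smul_eq_mul, inducedν_apply, X.sasakian.φ_skew (X.mem hx), X.sasakian.φ_φ _ (X.mem hx)]
  ring

theorem inner_curvature_N (u v w : Euc k) :
    K (f x) (fderiv ℝ f x w) (curvature K (f x) (fderiv ℝ f x u) (N x) (fderiv ℝ f x v))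
      = α * (-(β / α) + (c - 1) / 4) *
        (-2 * inducedν G φ f N x u * G (f x) (fderiv ℝ f x w) (φ (f x) (fderiv ℝ f x v))
          + -inducedν G φ f N x w * G (f x) (fderiv ℝ f x u) (φ (f x) (fderiv ℝ f x v))
          - inducedν G φ f N x v * G (f x) (fderiv ℝ f x w) (φ (f x) (fderiv ℝ f x u))) := by
  have hT : ∀ u, G (f x) (fderiv ℝ f x u) (N x) = 0 := fun u => by
    rw [X.inner_symm hx, X.normal.normal x hx]
  have hφN : ∀ u, G (f x) (fderiv ℝ f x u) (φ (f x) (N x)) = -inducedν G φ f N x u := fun u => by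
    rw [X.inner_symm hx, X.sasakian.φ_skew (X.mem hx), inducedν_apply]
  rw [R.apply (X.mem hx), R.curvature_eq X.sasakian (X.mem hx), X.sasakian.curv _ (X.mem hx)]
  simp only [map_add, map_sub, map_smul, map_neg, X.η_N hx, X.normal.normal x hx, hT,
    smul_eq_mul, X.sasakian.φ_skew (X.mem hx), X.sasakian.φ_φ _ (X.mem hx),
    X.sasakian.η_φ (X.mem hx), hφN]
  simp only [← inducedν_apply]
  ring

theorem formTrace_φ : formTrace (induced K f x) (fun u v =>
    G (f x) (fderiv ℝ f x u) (φ (f x) (fderiv ℝ f x v))) = 0 := by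
  have h1 := formTrace_eq_zero_of_antisymm
    ((X.immersion.riemannianOn_induced R.metric).inner x hx) (inducedΦ G φ f x).flip
    (fun u v => by
      rw [ContinuousLinearMap.flip_apply, ContinuousLinearMap.flip_apply, X.inducedΦ_skew hx])
  rw [← h1]
  congr 1
  ext u v
  rw [ContinuousLinearMap.flip_apply, inducedΦ_apply, X.inner_symm hx]

theorem formTrace_ν_mul (hαβ : α + β ≠ 0) (w : Euc k) : formTrace (induced K f x) (fun u v =>
    inducedν G φ f N x u * G (f x) (fderiv ℝ f x w) (φ (f x) (fderiv ℝ f x v))) = 0 := by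
  have h1 := formTrace_mul_apply (h := induced K f x) (inducedν G φ f N x)
    (G (f x) (fderiv ℝ f x w) ∘L φ (f x) ∘L fderiv ℝ f x)
  rw [X.inverse_deformation_ν hx R hαβ, map_smul] at h1
  simp only [ContinuousLinearMap.comp_apply] at h1
  rw [h1, X.inner_φ_V hx, smul_zero]

theorem formTrace_mul_ν (hαβ : α + β ≠ 0) (w : Euc k) : formTrace (induced K f x) (fun u v =>
    G (f x) (fderiv ℝ f x w) (φ (f x) (fderiv ℝ f x u)) * inducedν G φ f N x v) = 0 := by
  have h1 := formTrace_flip ((X.immersion.riemannianOn_induced R.metric).inner x hx)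
    ((inducedν G φ f N x).smulRight (G (f x) (fderiv ℝ f x w) ∘L φ (f x) ∘L fderiv ℝ f x))
  simp only [ContinuousLinearMap.smulRight_apply, smul_apply, smul_eq_mul,
    ContinuousLinearMap.comp_apply] at h1
  rw [X.formTrace_ν_mul hx R hαβ] at h1
  rw [← h1]
  simp only [mul_comm]

theorem formTrace_inner_N_curvature (hαβ : α + β ≠ 0) (w : Euc k) :
    formTrace (induced K f x) (fun u v => K (f x) (N x)
      (curvature K (f x) (fderiv ℝ f x u) (fderiv ℝ f x w) (fderiv ℝ f x v))) = 0 := by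
  have e : (fun u v => K (f x) (N x)
      (curvature K (f x) (fderiv ℝ f x u) (fderiv ℝ f x w) (fderiv ℝ f x v)))
      = fun u v => α * (-(β / α) + (c - 1) / 4) *
        (-2 * (G (f x) (fderiv ℝ f x w) (φ (f x) (fderiv ℝ f x u)) * inducedν G φ f N x v)
          + inducedν G φ f N x w * G (f x) (fderiv ℝ f x u) (φ (f x) (fderiv ℝ f x v))
          - inducedν G φ f N x u * G (f x) (fderiv ℝ f x w) (φ (f x) (fderiv ℝ f x v))) := by
    ext u v
    rw [X.deformation_N hx R, X.inner_N_curvature hx R]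
    have : G (f x) (fderiv ℝ f x u) (φ (f x) (fderiv ℝ f x w))
        = -G (f x) (fderiv ℝ f x w) (φ (f x) (fderiv ℝ f x u)) := by
      rw [X.inner_symm hx, X.sasakian.φ_skew (X.mem hx)]
    rw [this]
    ring
  rw [e, formTrace_mul, formTrace_sub, formTrace_add, formTrace_mul, formTrace_mul,
    X.formTrace_mul_ν hx R hαβ, X.formTrace_φ hx R, X.formTrace_ν_mul hx R hαβ]
  ring

theorem formTrace_inner_curvature_N (hαβ : α + β ≠ 0) (w : Euc k) :
    formTrace (induced K f x) (fun u v => K (f x) (fderiv ℝ f x w)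
      (curvature K (f x) (fderiv ℝ f x u) (N x) (fderiv ℝ f x v))) = 0 := by
  have e : (fun u v => K (f x) (fderiv ℝ f x w)
      (curvature K (f x) (fderiv ℝ f x u) (N x) (fderiv ℝ f x v)))
      = fun u v => α * (-(β / α) + (c - 1) / 4) *
        (-2 * (inducedν G φ f N x u * G (f x) (fderiv ℝ f x w) (φ (f x) (fderiv ℝ f x v)))
          + -inducedν G φ f N x w * G (f x) (fderiv ℝ f x u) (φ (f x) (fderiv ℝ f x v))
          - G (f x) (fderiv ℝ f x w) (φ (f x) (fderiv ℝ f x u)) * inducedν G φ f N x v) := by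
    ext u v
    rw [X.inner_curvature_N hx R]
    ring
  rw [e, formTrace_mul, formTrace_sub, formTrace_add, formTrace_mul, formTrace_mul,
    X.formTrace_mul_ν hx R hαβ, X.formTrace_φ hx R, X.formTrace_ν_mul hx R hαβ]
  ring

/-- The tangential part of the biharmonic equation for the normal field `hN` with respect to the
deformed metric, where `h` is the mean curvature function of the original metric. -/
theorem tangential_equation (hαβ : α + β = k) (hk : (k : ℝ) ≠ 0) {h : Euc k → ℝ}
    (hh : ∀ x ∈ U, ContDiffAt ℝ ∞ h x)
    (htr : ∀ x ∈ U, formTrace (induced G f x) (fun u v => scalarForm G f N x u v) = k * h x)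
    (hbi : metricTrace (induced K f x) (covAlong₂ K f (fun z => h z • N z) x)
      - metricTrace (induced K f x) (fun u v =>
        curvature K (f x) (fderiv ℝ f x u) (h x • N x) (fderiv ℝ f x v)) = 0) (w : Euc k) :
    scalarForm G f N x ((induced G f x).inverse (fderiv ℝ h x)) w
      - β / α * fderiv ℝ h x ((induced G f x).inverse (inducedν G φ f N x)) * inducedη η f x w
      = -(k / 2 * h x * fderiv ℝ h x w) := by
  have hα := R.α_pos.ne'
  have hne : α + β ≠ 0 := by rwa [hαβ]
  have hg := X.induced_metric.inner x hx
  have hKs := (R.metric.inner _ (X.mem hx)).symm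
  have h1 := congrArg (K (f x) (fderiv ℝ f x w)) hbi
  have hcurv : ∀ u v, curvature K (f x) (fderiv ℝ f x u) (h x • N x) (fderiv ℝ f x v)
      = h x • curvature K (f x) (fderiv ℝ f x u) (N x) (fderiv ℝ f x v) := by
    intro u v
    simp only [curvature, map_smul, smul_apply]
    module
  have hder : fderiv ℝ (fun z => formTrace (induced K f z) fun u v => scalarForm K f N z u v) x w
      = k * fderiv ℝ h x w := by
    have e : (fun z => formTrace (induced K f z) fun u v => scalarForm K f N z u v)
        =ᶠ[𝓝 x] fun z => k * h z := by
      filter_upwards [X.immersion.mem_nhds hx] with z hz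
      rw [X.formTrace_scalarForm_deformation hz R hne, htr z hz]
    rw [e.fderiv_eq, fderiv_const_mul ((hh x hx).differentiableAt (by simp))]
    simp
  rw [map_sub, map_zero, hKs,
    (X.normal_deformation R).inner_metricTrace_covAlong₂ X.immersion R.metric hx hh, hder,
    X.formTrace_inner_N_curvature hx R hne, map_metricTrace] at h1
  simp only [hcurv, map_smul, smul_eq_mul] at h1
  rw [formTrace_mul, X.formTrace_inner_curvature_N hx R hne, X.inverse_deformation hx R hne] at h1
  simp only [map_sub, map_smul, sub_apply, smul_apply, smul_eq_mul, X.scalarForm_deformation hx R,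
    X.scalarForm_ζ hx, X.inducedν_ζ hx, X.inducedη_ζ hx,
    hg.apply_inverse_comm (inducedη η f x) (fderiv ℝ h x),
    hg.apply_inverse_comm (inducedν G φ f N x) (fderiv ℝ h x)] at h1
  have hβ : β = k - α := by linarith
  subst hβ
  rw [add_sub_cancel] at h1
  field_simp at h1 ⊢
  refine mul_left_cancel₀ hk ?_
  linear_combination (-1 : ℝ) * h1

end Deformation

end ReebHypersurface

end Reeb

/-! ### The local theorem -/

section Local

theorem covAlong_congr {k n : ℕ} {G : FormField n} {f σ τ : Euc k → Euc n} {x : Euc k}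
    (h : σ =ᶠ[𝓝 x] τ) (u : Euc k) : covAlong G f σ x u = covAlong G f τ x u := by
  rw [covAlong, covAlong, h.fderiv_eq, h.self_of_nhds]

theorem covAlong₂_congr {k n : ℕ} {G : FormField n} {f σ τ : Euc k → Euc n} {x : Euc k}
    (h : σ =ᶠ[𝓝 x] τ) (u v : Euc k) : covAlong₂ G f σ x u v = covAlong₂ G f τ x u v := by
  have h1 : (fun z => covAlong G f σ z v) =ᶠ[𝓝 x] fun z => covAlong G f τ z v := by
    filter_upwards [h.eventuallyEq_nhds] with z hz using covAlong_congr hz v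
  rw [covAlong₂, covAlong₂, covAlong_congr h1, covAlong_congr h]

variable {k : ℕ} {U : Set (Euc k)} {W : Set (Euc (k + 1))} {G : FormField (k + 1)}
  {f : Euc k → Euc (k + 1)}

namespace ImmersionOn

variable (hf : ImmersionOn U W f) (hG : RiemannianOn W G) {x : Euc k} (hx : x ∈ U)
include hf hG hx

theorem exists_isUnitNormal : ∃ ν, IsUnitNormal G f x ν := by
  have hin := hG.inner _ (hf.mapsTo x hx)
  let L : Euc (k + 1) →ₗ[ℝ] Euc k :=
    ((induced G f x).inverse ∘L (fderiv ℝ f x).precomp ℝ ∘L G (f x) : Euc (k + 1) →L[ℝ] Euc k)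
  have hker : LinearMap.ker L ≠ ⊥ := LinearMap.ker_ne_bot_of_finrank_lt (by simp)
  obtain ⟨ν, hν, hν0⟩ := Submodule.exists_mem_ne_zero_of_ne_bot hker
  have hL : (fderiv ℝ f x).precomp ℝ (G (f x) ν) = 0 := by
    have h1 : (induced G f x).inverse ((fderiv ℝ f x).precomp ℝ (G (f x) ν)) = 0 := hν
    rw [← ((hf.riemannianOn_induced hG).inner x hx).apply_inverse
      ((fderiv ℝ f x).precomp ℝ (G (f x) ν)), h1, map_zero]
  have hnorm : ∀ u, G (f x) ν (fderiv ℝ f x u) = 0 := fun u =>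
    congrArg (fun a : Euc k →L[ℝ] ℝ => a u) hL
  have hpos := hin.pos ν hν0
  refine ⟨(√(G (f x) ν ν))⁻¹ • ν, fun u => ?_, ?_⟩
  · rw [map_smul, smul_apply, hnorm, smul_zero]
  · rw [map_smul, map_smul, smul_apply, smul_eq_mul, smul_eq_mul, ← mul_assoc, ← mul_inv,
      Real.mul_self_sqrt hpos.le, inv_mul_cancel₀ hpos.ne']

theorem inner_meanCurv (u : Euc k) : G (f x) (meanCurv G f x) (fderiv ℝ f x u) = 0 := by
  rw [(hG.inner _ (hf.mapsTo x hx)).symm, meanCurv, map_smul, map_metricTrace]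
  simp only [(hG.inner _ (hf.mapsTo x hx)).symm (fderiv ℝ f x u), hf.inner_secondForm hx hG]
  simp [formTrace]

theorem contDiffAt_meanCurv : ContDiffAt ℝ ∞ (meanCurv G f) x := by
  have h1 : ∀ i : Fin k, ContDiffAt ℝ ∞ (fun z => secondForm G f z (EuclideanSpace.single i 1)
      ((induced G f z).inverse (EuclideanSpace.proj i : Euc k →L[ℝ] ℝ))) x := fun i =>
    ((hf.contDiffAt_secondForm hx hG).clm_apply contDiffAt_const).clm_apply
      (((hf.riemannianOn_induced hG).contDiffAt_inverse hx).clm_apply contDiffAt_const)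
  exact (ContDiffAt.sum fun i _ => h1 i).const_smul (1 / (k : ℝ))

theorem meanCurvNorm_pos (hgrad : ∀ ν, IsUnitNormal G f x ν → gradMeanCurvNorm G f x ≠ 0) :
    0 < meanCurvNorm G f x := by
  obtain ⟨ν, hν⟩ := hf.exists_isUnitNormal hG hx
  refine (Real.sqrt_nonneg _).lt_of_ne fun h0 => hgrad ν hν ?_
  have hmin : IsLocalMin (meanCurvNorm G f) x := by
    refine Filter.Eventually.of_forall fun z => ?_
    rw [meanCurvNorm, ← h0]
    exact Real.sqrt_nonneg _
  rw [gradMeanCurvNorm, hmin.fderiv_eq_zero, map_zero]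

end ImmersionOn

variable {φ : Euc (k + 1) → Euc (k + 1) →L[ℝ] Euc (k + 1)} {ξ : Euc (k + 1) → Euc (k + 1)}
  {η : Euc (k + 1) → Euc (k + 1) →L[ℝ] ℝ} {c : ℝ}

/-- A piece of a pseudo-Hopf hypersurface on which the gradient of the mean curvature does not
vanish is not Ricci-biharmonic. -/
theorem not_exists_ricciBiharmonic (S : SasakianOn W G φ ξ η c)
    (hRic : ∀ y ∈ W, ∀ u, u ≠ 0 → 0 < ricciForm G y u u) (hf : ImmersionOn U W f)
    {x₀ : Euc k} (hx₀ : x₀ ∈ U) (htan : ∀ x ∈ U, ∃ u, fderiv ℝ f x u = ξ (f x))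
    (hinv : ∀ x ∈ U, ∀ ν, IsUnitNormal G f x ν → ∀ u,
      fderiv ℝ f x u ∈ Submodule.span ℝ {ξ (f x), -φ (f x) ν} →
      fderiv ℝ f x (weingarten G f x ν u) ∈ Submodule.span ℝ {ξ (f x), -φ (f x) ν})
    (hbi : ∀ x ∈ U, ricciBitension G f x = 0)
    (hgrad : ∀ x ∈ U, ∀ ν, IsUnitNormal G f x ν → gradMeanCurvNorm G f x ≠ 0) : False := by
  have hG := S.metric
  set h := meanCurvNorm G f with hh
  have hpos : ∀ x ∈ U, 0 < h x := fun x hx => hf.meanCurvNorm_pos hG hx (hgrad x hx)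
  have hsq : ∀ x ∈ U, G (f x) (meanCurv G f x) (meanCurv G f x) = h x * h x := fun x hx =>
    (Real.mul_self_sqrt ((hG.inner _ (hf.mapsTo x hx)).nonneg _)).symm
  have hsm : ∀ x ∈ U, ContDiffAt ℝ ∞ h x := by
    intro x hx
    refine ContDiffAt.sqrt (((hf.contDiffAt_metric hx hG).clm_apply
      (hf.contDiffAt_meanCurv hG hx)).clm_apply (hf.contDiffAt_meanCurv hG hx)) ?_
    rw [hsq x hx]
    exact (mul_pos (hpos x hx) (hpos x hx)).ne'
  set N : Euc k → Euc (k + 1) := fun x => (h x)⁻¹ • meanCurv G f x with hNdef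
  have hHN : ∀ x ∈ U, meanCurv G f x = h x • N x := fun x hx => by
    rw [hNdef, smul_inv_smul₀ (hpos x hx).ne']
  have hN : NormalOn U G f N 1 :=
    { smooth := fun x hx => ((hsm x hx).inv (hpos x hx).ne').smul (hf.contDiffAt_meanCurv hG hx)
      normal := fun x hx u => by
        simp only [hNdef, map_smul, smul_apply, hf.inner_meanCurv hG hx, smul_zero]
      norm := fun x hx => by
        have := (hpos x hx).ne'
        simp only [hNdef, map_smul, smul_apply, smul_eq_mul, hsq x hx]
        field_simp
      pos := one_pos }
  clear_value N
  have X : ReebHypersurface U W G φ ξ η c f N := ⟨S, hf, hN, htan⟩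
  set α : ℝ := (c - 1) / 2 + ((k + 1 : ℕ) - 1) * (c + 3) / 4 with hα
  set β : ℝ := -((c - 1) * ((k + 1 : ℕ) + 1) / 4) with hβ
  have hK : ∀ y ∈ W, ricciForm G y = α • G y + β • (η y).smulRight (η y) := fun y hy =>
    S.ricciForm_eq hy
  have hy₀ := X.mem hx₀
  have hαβ : α + β = k := by
    rw [hα, hβ]
    push_cast
    ring
  have hξ0 : ξ (f x₀) ≠ 0 := fun h0 => by
    have := S.η_ξ _ hy₀
    rw [h0, map_zero] at this
    exact zero_ne_one this
  have hN0 : N x₀ ≠ 0 := fun h0 => by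
    have := hN.norm x₀ hx₀
    rw [h0, map_zero] at this
    exact zero_ne_one this
  have hkpos : (0 : ℝ) < k := by
    have h1 := hRic _ hy₀ _ hξ0
    rw [hK _ hy₀] at h1
    simp [S.η_ξ _ hy₀, S.inner_ξ hy₀] at h1
    linarith
  have hαpos : 0 < α := by
    have h1 := hRic _ hy₀ _ hN0
    rw [hK _ hy₀] at h1
    simp [X.η_N hx₀, hN.norm x₀ hx₀] at h1
    exact h1
  have hR : DeformationOn W G (ricciForm G) η α β :=
    { metric :=
        { isOpen := hG.isOpen
          smooth := fun y hy => by
            have e : ricciForm G =ᶠ[𝓝 y] fun z => α • G z + β • (η z).smulRight (η z) := by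
              filter_upwards [hG.mem_nhds hy] with z hz using hK z hz
            refine ContDiffAt.congr_of_eventuallyEq ?_ e
            exact ((hG.smooth y hy).const_smul α).add
              (((S.contDiffAt_η hy).smulRight (S.contDiffAt_η hy)).const_smul β)
          inner := fun y hy =>
            { symm := fun u v => by
                rw [hK y hy]
                simp [(hG.inner y hy).symm u v, mul_comm]
              pos := hRic y hy } }
      eq := hK
      α_pos := hαpos }
  have htr : ∀ x ∈ U, formTrace (induced G f x) (fun u v => scalarForm G f N x u v) = k * h x := by
    intro x hx
    have h1 := congrArg (G (f x) (N x)) (hHN x hx)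
    rw [map_smul, hN.norm x hx, meanCurv, map_smul, map_metricTrace, smul_eq_mul, smul_eq_mul,
      mul_one] at h1
    simp only [scalarForm_apply]
    rw [← h1]
    field_simp
  have hb_V : ∀ x ∈ U, ∀ w, scalarForm G f N x ((induced G f x).inverse (inducedν G φ f N x)) w
      = -inducedη η f x w
        + scalarForm G f N x ((induced G f x).inverse (inducedν G φ f N x))
          ((induced G f x).inverse (inducedν G φ f N x)) * inducedν G φ f N x w := by
    intro x hx
    have hg := X.induced_metric.inner x hx
    have h1 := hinv x hx (N x) ⟨hN.normal x hx, hN.norm x hx⟩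
      ((induced G f x).inverse (inducedν G φ f N x)) (by
        rw [X.fderiv_V hx]
        exact Submodule.subset_span (by simp))
    obtain ⟨s, t, hst⟩ := Submodule.mem_span_pair.1 h1
    have h2 : ∀ w, scalarForm G f N x ((induced G f x).inverse (inducedν G φ f N x)) w
        = s * inducedη η f x w + t * inducedν G φ f N x w := by
      intro w
      have e : weingarten G f x (N x) ((induced G f x).inverse (inducedν G φ f N x))
          = s • (induced G f x).inverse (inducedη η f x)
            + t • (induced G f x).inverse (inducedν G φ f N x) := by
        refine hf.injective x hx ?_
        rw [← hst, map_add, map_smul, map_smul, X.fderiv_ζ hx, X.fderiv_V hx]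
      have e2 := congrArg (fun v => induced G f x v w) e
      simp only [map_add, map_smul, add_apply, smul_apply, hg.apply_inverse, smul_eq_mul] at e2
      rw [← e2]
      change _ = induced G f x ((induced G f x).inverse
        (scalarForm G f N x ((induced G f x).inverse (inducedν G φ f N x)))) w
      rw [hg.apply_inverse]
    have h3 := h2 ((induced G f x).inverse (inducedη η f x))
    rw [X.scalarForm_comm hx, X.scalarForm_ζ hx, X.inducedν_V hx, X.inducedη_ζ hx,
      X.inducedν_ζ hx] at h3
    have h4 := h2 ((induced G f x).inverse (inducedν G φ f N x))
    rw [X.inducedη_V hx, X.inducedν_V hx] at h4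
    intro w
    rw [h4, h2 w]
    linear_combination (-inducedη η f x w) * h3
  have hcpos : 0 < c + 3 := by
    have h1 : (c + 3) * (k + 2) = 4 * α + 8 := by
      rw [hα]
      push_cast
      ring
    have h2 : 0 < (c + 3) * (k + 2) := by linarith
    exact pos_of_mul_pos_left h2 (by positivity)
  have D : PseudoHopfData U (induced G f) (scalarForm G f N) (inducedΦ G φ f) (inducedη η f)
      (inducedν G φ f N) h c α β (k / 2) :=
    { metric := X.induced_metric
      smooth_b := fun x hx => hN.contDiffAt_scalarForm hf hG hx
      smooth_η := fun x hx => X.contDiffAt_inducedη hx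
      smooth_ν := fun x hx => X.contDiffAt_inducedν hx
      smooth_h := hsm
      b_symm := fun x hx => X.scalarForm_comm hx
      Φ_skew := fun x hx => X.inducedΦ_skew hx
      η_V := fun x hx => X.inducedη_V hx
      ν_V := fun x hx => X.inducedν_V hx
      η_ζ := fun x hx => X.inducedη_ζ hx
      Φ_V := fun x hx => X.inducedΦ_V hx
      Φ_ζ := fun x hx => X.inducedΦ_ζ hx
      Φ_nondeg := fun x hx => X.inducedΦ_nondeg hx
      cov_η := fun x hx => X.cov_inducedη hx
      cov_ν := fun x hx => X.cov_inducedν hx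
      b_ζ := fun x hx => X.scalarForm_ζ hx
      b_V := hb_V
      codazzi := fun x hx => X.codazzi hx
      tangential := fun x hx => by
        refine X.tangential_equation hx hR hαβ hkpos.ne' hsm htr ?_
        have e : meanCurv G f =ᶠ[𝓝 x] fun z => h z • N z := by
          filter_upwards [hf.mem_nhds hx] with z hz using hHN z hz
        have h1 := hbi x hx
        have e2 : covAlong₂ (ricciForm G) f (meanCurv G f) x
            = covAlong₂ (ricciForm G) f (fun z => h z • N z) x := by
          ext1 u
          ext1 v
          exact covAlong₂_congr e u v
        rw [ricciBitension, laplacian, neg_neg, e2, hHN x hx] at h1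
        exact h1
      h_pos := hpos
      h_ne := fun x hx h0 => by
        obtain ⟨ν, hν⟩ := hf.exists_isUnitNormal hG hx
        exact hgrad x hx ν hν (by rw [gradMeanCurvNorm, ← hh, h0, map_zero])
      α_pos := hαpos
      r_pos := by positivity
      c_pos := hcpos
      add_eq := by rw [hαβ]; ring }
  exact D.not_pseudoHopfData hx₀

end Local

/-! ### From manifolds to coordinates -/

section Charts

variable {n : ℕ} {N : Type*} [TopologicalSpace N] [ChartedSpace (Euc n) N]
  [IsManifold (𝓡 n) ∞ N]

namespace AlmostContactMetric

theorem isManifold_one (n : ℕ) (N : Type*) [TopologicalSpace N] [ChartedSpace (Euc n) N]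
    [IsManifold (𝓡 n) ∞ N] : IsManifold (𝓡 n) 1 N :=
  IsManifold.of_le (n := ∞) (by simp)

section Frame

variable {x₀ : N} {y : Euc n} (hy : y ∈ (extChartAt (𝓡 n) x₀).target)
include hy

omit [IsManifold (𝓡 n) ∞ N] in
theorem symm_mem_source : (extChartAt (𝓡 n) x₀).symm y ∈ (chartAt (Euc n) x₀).source := by
  rw [← extChartAt_source (𝓡 n)]
  exact (extChartAt (𝓡 n) x₀).map_target hy

theorem coframe_frame (u : Euc n) : coframe x₀ y (frame x₀ y u) = u := by
  have := isManifold_one n N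
  have h1 := mfderiv_extChartAt_comp_mfderivWithin_extChartAt_symm (I := 𝓡 n) hy
  rw [ModelWithCorners.range_eq_univ, mfderivWithin_univ] at h1
  exact congrArg (fun L : Euc n →L[ℝ] Euc n => L u) h1

theorem frame_coframe (v : TangentSpace (𝓡 n) ((extChartAt (𝓡 n) x₀).symm y)) :
    frame x₀ y (coframe x₀ y v) = v := by
  have := isManifold_one n N
  have h1 := mfderivWithin_extChartAt_symm_comp_mfderiv_extChartAt (I := 𝓡 n) hy
  rw [ModelWithCorners.range_eq_univ, mfderivWithin_univ] at h1
  exact congrArg (fun L : Euc n →L[ℝ] Euc n => L v) h1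

theorem frame_eq_symmL : frame x₀ y = (trivializationAt (Euc n)
    (fun x : N => TangentSpace (𝓡 n) x) x₀).symmL ℝ ((extChartAt (𝓡 n) x₀).symm y) := by
  have := isManifold_one n N
  have h1 := TangentBundle.symmL_trivializationAt (I := 𝓡 n) (symm_mem_source hy)
  rw [ModelWithCorners.range_eq_univ, mfderivWithin_univ,
    (extChartAt (𝓡 n) x₀).right_inv hy] at h1
  exact h1.symm

theorem coframe_eq_continuousLinearMapAt : coframe x₀ y = (trivializationAt (Euc n)
    (fun x : N => TangentSpace (𝓡 n) x) x₀).continuousLinearMapAt ℝ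
      ((extChartAt (𝓡 n) x₀).symm y) := by
  have := isManifold_one n N
  exact (TangentBundle.continuousLinearMapAt_trivializationAt (I := 𝓡 n)
    (symm_mem_source hy)).symm

theorem symm_mem_baseSet : (extChartAt (𝓡 n) x₀).symm y ∈ (trivializationAt (Euc n)
    (fun x : N => TangentSpace (𝓡 n) x) x₀).baseSet := by
  simpa using symm_mem_source hy

theorem contDiffAt_comp_symm {E : Type*} [NormedAddCommGroup E] [NormedSpace ℝ E] {s : N → E}
    (hs : ContMDiffAt (𝓡 n) 𝓘(ℝ, E) ∞ s ((extChartAt (𝓡 n) x₀).symm y)) :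
    ContDiffAt ℝ ∞ (fun z => s ((extChartAt (𝓡 n) x₀).symm z)) y := by
  rw [← contMDiffAt_iff_contDiffAt]
  have h1 : ContMDiffAt 𝓘(ℝ, Euc n) (𝓡 n) ∞ (extChartAt (𝓡 n) x₀).symm y :=
    (contMDiffOn_extChartAt_symm x₀).contMDiffAt ((isOpen_extChartAt_target x₀).mem_nhds hy)
  exact hs.comp y h1

end Frame

variable (S : AlmostContactMetric n N) {x₀ : N} {y : Euc n}

theorem locG_apply (u v : Euc n) : S.locG x₀ y u v
    = S.g.inner ((extChartAt (𝓡 n) x₀).symm y) (frame x₀ y u) (frame x₀ y v) := rfl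

variable (hy : y ∈ (extChartAt (𝓡 n) x₀).target)
include hy

theorem contDiffAt_locξ : ContDiffAt ℝ ∞ (S.locξ x₀) y := by
  have h1 := (Bundle.Trivialization.contMDiffAt_section_iff
    (trivializationAt (Euc n) (fun x : N => TangentSpace (𝓡 n) x) x₀)
    (symm_mem_baseSet hy)).1 (S.ξ.contMDiff ((extChartAt (𝓡 n) x₀).symm y))
  refine (contDiffAt_comp_symm hy h1).congr_of_eventuallyEq ?_
  filter_upwards [(isOpen_extChartAt_target x₀).mem_nhds hy] with z hz
  rw [locξ, coframe_eq_continuousLinearMapAt hz,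
    Bundle.Trivialization.continuousLinearMapAt_apply_of_mem _ _ (symm_mem_baseSet hz)]

theorem contDiffAt_locφ : ContDiffAt ℝ ∞ (S.locφ x₀) y := by
  have h1 := (Bundle.Trivialization.contMDiffAt_section_iff
    (trivializationAt (Euc n →L[ℝ] Euc n)
      (fun x : N => TangentSpace (𝓡 n) x →L[ℝ] TangentSpace (𝓡 n) x) x₀)
    (by simpa using symm_mem_source hy)).1 (S.φ.contMDiff ((extChartAt (𝓡 n) x₀).symm y))
  refine (contDiffAt_comp_symm hy h1).congr_of_eventuallyEq ?_
  filter_upwards [(isOpen_extChartAt_target x₀).mem_nhds hy] with z hz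
  rw [hom_trivializationAt_apply, locφ, coframe_eq_continuousLinearMapAt hz, frame_eq_symmL hz]
  rfl

theorem contDiffAt_locG : ContDiffAt ℝ ∞ (S.locG x₀) y := by
  have h1 := (Bundle.Trivialization.contMDiffAt_section_iff
    (trivializationAt (Euc n →L[ℝ] Euc n →L[ℝ] ℝ)
      (fun x : N => TangentSpace (𝓡 n) x →L[ℝ] TangentSpace (𝓡 n) x →L[ℝ] ℝ) x₀)
    (by simpa using symm_mem_source hy)).1 (S.g.contMDiff ((extChartAt (𝓡 n) x₀).symm y))
  refine (contDiffAt_comp_symm hy h1).congr_of_eventuallyEq ?_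
  filter_upwards [(isOpen_extChartAt_target x₀).mem_nhds hy] with z hz
  ext u v
  have hfr : ∀ u, frame x₀ z u = (trivializationAt (Euc n)
      (fun x : N => TangentSpace (𝓡 n) x) x₀).symm ((extChartAt (𝓡 n) x₀).symm z) u := fun u => by
    rw [frame_eq_symmL hz]
    exact Bundle.Trivialization.symmL_apply _ (symm_mem_baseSet hz) u
  rw [hom_trivializationAt_apply, locG_apply, hfr, hfr]
  have := inCoordinates_apply_eq₂ (𝕜 := ℝ) (F₁ := Euc n) (F₂ := Euc n) (F₃ := ℝ)
    (E₁ := fun x : N => TangentSpace (𝓡 n) x) (E₂ := fun x : N => TangentSpace (𝓡 n) x)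
    (E₃ := Bundle.Trivial N ℝ) (ϕ := S.g.inner ((extChartAt (𝓡 n) x₀).symm z)) (v := u) (w := v)
    (symm_mem_baseSet hz) (symm_mem_baseSet hz) (by simp)
  refine Eq.trans ?_ this.symm
  simp

theorem frame_ne_zero {u : Euc n} (hu : u ≠ 0) : frame x₀ y u ≠ 0 := fun h0 =>
  hu (by rw [← coframe_frame hy u, h0, map_zero])

omit hy in
theorem riemannianOn_locG : RiemannianOn (extChartAt (𝓡 n) x₀).target (S.locG x₀) where
  isOpen := isOpen_extChartAt_target x₀
  smooth _ hy := S.contDiffAt_locG hy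
  inner _ hy :=
    { symm := fun _ _ => S.g.symm _ _ _
      pos := fun _ hu => S.g.pos _ _ (frame_ne_zero hy hu) }

omit hy in
theorem IsSasakianSpaceForm.sasakianOn {c : ℝ} (hS : S.IsSasakianSpaceForm c) (x₀ : N) :
    SasakianOn (extChartAt (𝓡 n) x₀).target (S.locG x₀) (S.locφ x₀) (S.locξ x₀) (S.locη x₀) c where
  metric := S.riemannianOn_locG
  smooth_φ y hy := S.contDiffAt_locφ hy
  smooth_ξ y hy := S.contDiffAt_locξ hy
  φ_φ y hy u := by
    simp only [locφ, locη, locξ, ContinuousLinearMap.comp_apply]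
    rw [frame_coframe hy, S.φ_φ, map_add, map_neg, map_smul, coframe_frame hy]
  η_ξ y hy := by
    simp only [locη, locξ, ContinuousLinearMap.comp_apply]
    rw [frame_coframe hy, S.η_ξ]
  φ_ξ y hy := by
    simp only [locφ, locξ, ContinuousLinearMap.comp_apply]
    rw [frame_coframe hy, S.φ_ξ, map_zero]
  η_eq y hy u := by
    rw [locG_apply]
    simp only [locη, locξ, ContinuousLinearMap.comp_apply]
    rw [frame_coframe hy, S.η_eq]
  G_φ_φ y hy u v := by
    rw [locG_apply, locG_apply]
    simp only [locη, locφ, ContinuousLinearMap.comp_apply]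
    rw [frame_coframe hy, frame_coframe hy, S.g_φ_φ]
  sasaki y hy := hS.sasaki x₀ y hy
  curv y hy := hS.curv x₀ y hy

omit hy in
theorem locξ_chart {q : N} (hq : q ∈ (extChartAt (𝓡 n) x₀).source) :
    S.locξ x₀ (extChartAt (𝓡 n) x₀ q)
      = mfderiv (𝓡 n) 𝓘(ℝ, Euc n) (extChartAt (𝓡 n) x₀) q (S.ξ q) := by
  have key : ∀ q' : N, q' = q →
      (mfderiv (𝓡 n) 𝓘(ℝ, Euc n) (extChartAt (𝓡 n) x₀) q' (S.ξ q') : Euc n)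
        = mfderiv (𝓡 n) 𝓘(ℝ, Euc n) (extChartAt (𝓡 n) x₀) q (S.ξ q) := by
    rintro _ rfl
    rfl
  exact key _ ((extChartAt (𝓡 n) x₀).left_inv hq)

end AlmostContactMetric

open AlmostContactMetric

variable {k : ℕ} {M : Type*} [TopologicalSpace M] [ChartedSpace (Euc k) M]
  [IsManifold (𝓡 k) ∞ M] {ψ : M → N}

omit [IsManifold (𝓡 n) ∞ N] [IsManifold (𝓡 k) ∞ M] in
theorem isOpen_locDomain (hψ : IsSmoothImmersion k n ψ) (p₀ : M) :
    IsOpen (locDomain k n ψ p₀) :=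
  (continuousOn_extChartAt_symm p₀).isOpen_inter_preimage (isOpen_extChartAt_target p₀)
    ((isOpen_extChartAt_source (ψ p₀)).preimage hψ.1.continuous)

omit [IsManifold (𝓡 n) ∞ N] [IsManifold (𝓡 k) ∞ M] in
theorem chart_mem_locDomain (p₀ : M) : extChartAt (𝓡 k) p₀ p₀ ∈ locDomain k n ψ p₀ := by
  refine ⟨mem_extChartAt_target p₀, ?_⟩
  simp

theorem fderiv_locMap (hψ : IsSmoothImmersion k n ψ) {p₀ : M} {x : Euc k}
    (hx : x ∈ locDomain k n ψ p₀) (u : Euc k) :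
    fderiv ℝ (locMap k n ψ p₀) x u
      = mfderiv (𝓡 n) 𝓘(ℝ, Euc n) (extChartAt (𝓡 n) (ψ p₀)) (ψ ((extChartAt (𝓡 k) p₀).symm x))
        (mfderiv (𝓡 k) (𝓡 n) ψ ((extChartAt (𝓡 k) p₀).symm x) (frame p₀ x u)) := by
  have := isManifold_one k M
  have := isManifold_one n N
  have h1 : MDifferentiableAt 𝓘(ℝ, Euc k) (𝓡 k) (extChartAt (𝓡 k) p₀).symm x := by
    have h0 := mdifferentiableWithinAt_extChartAt_symm (I := 𝓡 k) hx.1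
    rwa [ModelWithCorners.range_eq_univ, mdifferentiableWithinAt_univ] at h0
  have h2 : MDifferentiableAt (𝓡 k) (𝓡 n) ψ ((extChartAt (𝓡 k) p₀).symm x) :=
    (hψ.1 _).mdifferentiableAt (by simp)
  have h3 : MDifferentiableAt (𝓡 n) 𝓘(ℝ, Euc n) (extChartAt (𝓡 n) (ψ p₀))
      (ψ ((extChartAt (𝓡 k) p₀).symm x)) :=
    mdifferentiableAt_extChartAt (by
      rw [← extChartAt_source (𝓡 n)]
      exact hx.2)
  obtain ⟨L, hL, hLu⟩ : ∃ L : Euc k →L[ℝ] Euc n, HasFDerivAt (locMap k n ψ p₀) L x ∧ ∀ u, L u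
      = mfderiv (𝓡 n) 𝓘(ℝ, Euc n) (extChartAt (𝓡 n) (ψ p₀)) (ψ ((extChartAt (𝓡 k) p₀).symm x))
        (mfderiv (𝓡 k) (𝓡 n) ψ ((extChartAt (𝓡 k) p₀).symm x) (frame p₀ x u)) :=
    ⟨_, (h3.hasMFDerivAt.comp x (h2.hasMFDerivAt.comp x h1.hasMFDerivAt)).hasFDerivAt,
      fun _ => rfl⟩
  rw [hL.fderiv, hLu]

theorem immersionOn_locMap (hψ : IsSmoothImmersion k n ψ) (p₀ : M) :
    ImmersionOn (locDomain k n ψ p₀) (extChartAt (𝓡 n) (ψ p₀)).target (locMap k n ψ p₀) where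
  isOpen := isOpen_locDomain hψ p₀
  mapsTo x hx := (extChartAt (𝓡 n) (ψ p₀)).map_source hx.2
  smooth x hx := by
    have h1 : ContMDiffAt (𝓡 n) 𝓘(ℝ, Euc n) ∞ (extChartAt (𝓡 n) (ψ p₀))
        (ψ ((extChartAt (𝓡 k) p₀).symm x)) :=
      contMDiffAt_extChartAt' (by
        rw [← extChartAt_source (𝓡 n)]
        exact hx.2)
    exact contDiffAt_comp_symm (s := fun p => extChartAt (𝓡 n) (ψ p₀) (ψ p)) hx.1
      (h1.comp _ (hψ.1 _))
  injective x hx := by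
    have := isManifold_one n N
    intro u v huv
    rw [fderiv_locMap hψ hx, fderiv_locMap hψ hx] at huv
    have h1 := (isInvertible_mfderiv_extChartAt (I := 𝓡 n) hx.2).injective huv
    have h2 := hψ.2 _ h1
    rw [← coframe_frame hx.1 u, h2, coframe_frame hx.1]

end Charts

end RicciBiharmonic

theorem mainTheorem2 (m : ℕ) (c : ℝ)
    {N : Type*} [TopologicalSpace N] [ChartedSpace (RicciBiharmonic.Euc (2 * m + 1)) N]
    [IsManifold (𝓡 (2 * m + 1)) ∞ N]
    (S : RicciBiharmonic.AlmostContactMetric (2 * m + 1) N)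
    (hS : S.IsSasakianSpaceForm c) (hRic : S.RicciIsMetric)
    {M : Type*} [TopologicalSpace M] [ChartedSpace (RicciBiharmonic.Euc (2 * m)) M]
    [IsManifold (𝓡 (2 * m)) ∞ M] [Nonempty M]
    (ψ : M → N) (hψ : RicciBiharmonic.IsSmoothImmersion (2 * m) (2 * m + 1) ψ) :
    ¬ (RicciBiharmonic.IsPseudoHopf (k := 2 * m) S ψ ∧
      RicciBiharmonic.IsRicciBiharmonic (k := 2 * m) S ψ ∧
      RicciBiharmonic.GradIsPrincipal (k := 2 * m) S ψ) := by
  rintro ⟨hHopf, hbi, hgrad⟩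
  obtain ⟨p₀⟩ := (inferInstance : Nonempty M)
  refine RicciBiharmonic.not_exists_ricciBiharmonic (hS.sasakianOn S (ψ p₀)) (hRic (ψ p₀))
    (RicciBiharmonic.immersionOn_locMap hψ p₀) (RicciBiharmonic.chart_mem_locDomain p₀) (fun x hx => ?_)
    (fun x hx ν hν u hu => hHopf.invariant p₀ x hx ν hν u hu) (hbi p₀) (fun x hx ν hν => ?_)
  · obtain ⟨v, hv⟩ := hHopf.tangent ((extChartAt (𝓡 (2 * m)) p₀).symm x)
    refine ⟨RicciBiharmonic.AlmostContactMetric.coframe p₀ x v, ?_⟩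
    rw [RicciBiharmonic.fderiv_locMap hψ hx,
      RicciBiharmonic.AlmostContactMetric.frame_coframe hx.1, hv]
    exact (S.locξ_chart hx.2).symm
  · obtain ⟨μ, hμ⟩ := hgrad p₀ x hx ν hν
    exact hμ.2
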